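/- **Conventions.** A partial applicative structure on a set $A$ is a partial map $(a,b)\mapsto ab$ from $A\times A$ to $A$; application associates to the left. It is a partial combinatory algebra (pca) if there are $\mathsf k,\mathsf s\in A$ such that for all $a,b,c\in A$: $\mathsf s ab$ is defined, $\mathsf k ab=a$, and if $ac(bc)$ is defined then $\mathsf s abc$ is defined and equal to it. An applicative morphism $A\to B$ is a total relation $\gamma$ from $A$ to $B$ for which there is $r\in B$ such that whenever $aa'$ is defined, $x\in\gamma(a)$ and $y\in\gamma(a')$, then $rxy$ is defined and lies in $\gamma(aa')$. Morphisms compose as relations, the identity relation is the identity morphism, and two pcas are isomorphic if there are mutually inverse applicative morphisms between them. An element $a\in A$ is an index of a total function $g:A\to A$ if $ab=g(b)$ for all $b\in A$. **The pca $A[F]$.** Let $A$ be a pca with chosen $\mathsf k,\mathsf s$, booleans ($\mathsf Tab=a$, $\mathsf Fab=b$), pairing $\mathsf p$ with projections, Curry numerals ($\overline 0=\mathsf{skk}$, $\overline{n+1}=\mathsf p\mathsf F\overline n$), and a coding $[u_0,\dots,u_{n-1}]\in A$ of tuples for which one-element tuples, concatenation, length and projections are computable in $A$. For a partial function $f:A\to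 A$, the structure $A[f]$ has underlying set $A$ and application $a\cdot^f b=c$ if there are $u_0,\dots,u_{n-1}\in A$ such that for every $i<n$ one has $a[b,u_0,\dots,u_{i-1}]=\mathsf p\mathsf F v_i$ for some $v_i$ with $f(v_i)=u_i$, and $a[b,u_0,\dots,u_{n-1}]=\mathsf p\mathsf T c$. For a functional $F:A^A\to A$ define partial functions $f_\alpha$ by transfinite recursion: $f_0=\emptyset$; $f_{\alpha+1}(a)=F(g)$ whenever $g:A\to A$ is a total function of which $a$ is an index in $A[f_\alpha]$; $f_\lambda=\bigcup_{\alpha<\lambda}f_\alpha$ for limit $\lambda$. Put $A[F]:=A[\bigcup_\alpha f_\alpha]$. **Kleene computability.** Fix an injective primitive recursive coding $\langle-\rangle$ of finite sequences of natural numbers by natural numbers. For $F:\mathbb N^{\mathbb N}\to\mathbb N$, the partial functions $\{e\}:\mathbb N^{<\omega}\to\mathbb N$ are defined inductively as the least solution of the following clauses (a step whose right-hand side is undefined gives no value), where $\vec n$ ranges over finite sequences and $|\vec n|$ is the length: * (S1) $\{\langle1,|\vec n|+1\rangle\}(x,\vec n)=x+1$; * (S2) $\{\langle2,|\vec n|,m\rangle\}(\vec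 n)=m$; * (S3) $\{\langle3,|\vec n|+1\rangle\}(x,\vec n)=x$; * (S4) $\{\langle4,|\vec n|,g,h\rangle\}(\vec n)\simeq\{g\}(\{h\}(\vec n),\vec n)$; * (S5) for $m=\langle5,|\vec n|+1,g,h\rangle$: $\{m\}(0,\vec n)\simeq\{g\}(\vec n)$ and $\{m\}(k+1,\vec n)\simeq\{h\}(k,\{m\}(k,\vec n),\vec n)$; * (S6) for $1\le k<r$: $\{\langle6,r,k,g\rangle\}(n_1,\dots,n_r)\simeq\{g\}(n_{k+1},n_1,\dots,n_k,n_{k+2},\dots,n_r)$; * (S8) $\{\langle8,|\vec n|,h\rangle\}(\vec n)\simeq F(\lambda x.\{h\}(x,\vec n))$, defined only if $\lambda x.\{h\}(x,\vec n)$ is total; * (S9) $\{\langle9,k,l\rangle\}(m,n_1,\dots,n_{k+l})\simeq\{m\}(n_1,\dots,n_k)$. (S7 concerns type 1 arguments and is not needed.) Let $\mathcal K_1^F$ be $\mathbb N$ with application $(e,n)\mapsto\{e\}(n)$. A function $g:\mathbb N\to\mathbb N$ is Kleene-computable in $F$ if for some $e$, $\{e\}(n)=g(n)$ for all $n$. **Theorem.**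 Let $\mathcal K_1$ be Kleene's first model ($\mathbb N$ with $nm\simeq\varphi_n(m)$, $\varphi$ a standard enumeration of the partial recursive functions), with any choice of canonical elements and tuple coding as above, and let $F:\mathbb N^{\mathbb N}\to\mathbb N$ be a total functional. Then $\mathcal K_1[F]$ and $\mathcal K_1^F$ are pcas, and there is an isomorphism of pcas $\mathcal K_1[F]\cong\mathcal K_1^F$. Moreover a total function $g:\mathbb N\to\mathbb N$ is Kleene-computable in $F$ if and only if it has an index in $\mathcal K_1[F]$. -/

import Mathlib

universe u v w

namespace ForcedPCA

/-- The unique element satisfying `P`, defined exactly when there is exactly one such element. -/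
noncomputable def theUnique {A : Type u} (P : A → Prop) : Part A :=
  ⟨∃! c, P c, fun h => h.choose⟩

theorem mem_theUnique {A : Type u} {P : A → Prop} {c : A} :
    c ∈ theUnique P ↔ P c ∧ ∀ d, P d → d = c := by
  constructor
  · rintro ⟨h, rfl⟩
    exact h.choose_spec
  · rintro h
    have h' : ∃! c, P c := ⟨c, h⟩
    exact ⟨h', (h.2 _ h'.choose_spec.1)⟩

/-! ### Partial applicative structures and partial combinatory algebras

A partial applicative structure on `A` is a partial map `app : A → A → Part A`;
`c ∈ app a b` says that `ab` is defined and has value `c`. -/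

/-- `abc = (ab)c`. -/
def app2 {A : Type u} (app : A → A → Part A) (a b c : A) : Part A :=
  (app a b).bind fun x => app x c

/-- `abcd = ((ab)c)d`. -/
def app3 {A : Type u} (app : A → A → Part A) (a b c d : A) : Part A :=
  (app2 app a b c).bind fun x => app x d

/-- `k` and `s` witness combinatory completeness:
`sab↓`, `kab = a`, and `sabc ≲ ac(bc)`, i.e. if `ac(bc)` denotes then `sabc` denotes the same. -/
def IsKS {A : Type u} (app : A → A → Part A) (k s : A) : Prop :=
  (∀ a b, (app2 app s a b).Dom) ∧
  (∀ a b, a ∈ app2 app k a b) ∧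
  ∀ a b c, ∀ v ∈ (app a c).bind (fun x => (app b c).bind fun y => app x y), v ∈ app3 app s a b c

/-- The partial applicative structure `app` is a partial combinatory algebra. -/
def IsPCA {A : Type u} (app : A → A → Part A) : Prop :=
  ∃ k s, IsKS app k s

/-- A choice of canonical elements in a pca. -/
structure BasicCombinators {A : Type u} (app : A → A → Part A) where
  k : A
  s : A
  isKS : IsKS app k s
  /-- the identity combinator `skk` -/
  i : A
  i_eq : i ∈ app2 app s k k
  /-- the boolean `T` -/
  tt : A
  /-- the boolean `F` -/
  ff : A
  tt_app : ∀ a b, a ∈ app2 app tt a b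
  ff_app : ∀ a b, b ∈ app2 app ff a b
  p : A
  p₀ : A
  p₁ : A
  /-- `pair a b` is the value of `p a b` -/
  pair : A → A → A
  p_app : ∀ a b, pair a b ∈ app2 app p a b
  p₀_app : ∀ a b, a ∈ app p₀ (pair a b)
  p₁_app : ∀ a b, b ∈ app p₁ (pair a b)

/-- The Curry numerals: `skk` for zero, `p F n` for the successor of `n`. -/
def BasicCombinators.num {A : Type u} {app : A → A → Part A} (C : BasicCombinators app) : ℕ → A
  | 0 => C.i
  | n + 1 => C.pair C.ff (C.num n)

/-- A choice of canonical elements in a pca, together with a coding of tuples such that one-element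
tuples, concatenation, length (as a Curry numeral) and projections are computable in the pca. -/
structure Combinators {A : Type u} (app : A → A → Part A) extends BasicCombinators app where
  /-- the code `[u₀, …, uₙ]` -/
  tup : List A → A
  sing : A
  cat : A
  len : A
  proj : A
  sing_app : ∀ a, tup [a] ∈ app sing a
  cat_app : ∀ l l' : List A, tup (l ++ l') ∈ app2 app cat (tup l) (tup l')
  len_app : ∀ l : List A, toBasicCombinators.num l.length ∈ app len (tup l)
  proj_app : ∀ (l : List A) (n : ℕ) (a : A), l[n]? = some a →
    a ∈ app2 app proj (toBasicCombinators.num n) (tup l)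

/-! ### Applicative morphisms and isomorphisms -/

/-- A total relation `γ` from `A` to `B` that has a realizer `r`: whenever `aa'` is defined,
`r γ(a) γ(a')` is defined and contained in `γ(aa')`. -/
def IsApplicativeMorphism {A : Type u} {B : Type v} (appA : A → A → Part A) (appB : B → B → Part B)
    (γ : A → B → Prop) : Prop :=
  (∀ a, ∃ b, γ a b) ∧
  ∃ r : B, ∀ a a' c, c ∈ appA a a' → ∀ x y, γ a x → γ a' y → ∃ z ∈ app2 appB r x y, γ c z

/-- Isomorphism in the category of pcas and applicative morphisms, where morphisms are composed
as relations and the identity morphism is the identity relation. -/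
def AreIsomorphic {A : Type u} {B : Type v} (appA : A → A → Part A) (appB : B → B → Part B) : Prop :=
  ∃ (γ : A → B → Prop) (δ : B → A → Prop),
    IsApplicativeMorphism appA appB γ ∧ IsApplicativeMorphism appB appA δ ∧
    Relation.Comp γ δ = Eq ∧ Relation.Comp δ γ = Eq

/-! ### Representable functions -/

/-- The set of indices of a partial function `f`: all `a` with `ab ≲ f(b)` for all `b`. -/
def indices {A : Type u} (app : A → A → Part A) (f : A → Part A) : Set A :=
  {a | ∀ b, ∀ c ∈ f b, c ∈ app a b}

/-- The partial functions that have an index. -/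
def PR {A : Type u} (app : A → A → Part A) : Set (A → Part A) :=
  {f | (indices app f).Nonempty}

/-! ### Adjoining a partial function -/

/-- `u` is an `f`-dialogue between `a` and `b`: for every `i < |u|`,
`a([b] * u^{<i}) = p F v` for some `v` with `f(v) = uᵢ`. -/
def IsDialogue {A : Type u} {app : A → A → Part A} (C : Combinators app) (f : A → Part A) (a b : A)
    (u : List A) : Prop :=
  ∀ (i : ℕ) (hi : i < u.length), ∃ v,
    C.pair C.ff v ∈ app a (C.tup (b :: u.take i)) ∧ u[i] ∈ f v

/-- There is an `f`-dialogue between `a` and `b` that halts with result `c`. -/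
def HaltsWith {A : Type u} {app : A → A → Part A} (C : Combinators app) (f : A → Part A) (a b c : A) :
    Prop :=
  ∃ u, IsDialogue C f a b u ∧ C.pair C.tt c ∈ app a (C.tup (b :: u))

/-- The application of `A[f]`. -/
noncomputable def adjoin {A : Type u} {app : A → A → Part A} (C : Combinators app) (f : A → Part A) :
    A → A → Part A :=
  fun a b => theUnique (HaltsWith C f a b)

/-! ### Forcing a functional to be an effective operation -/

/-- The partial functions `f_α`, for `α` an ordinal: `f₀` is empty; `f_{α+1}(a) = F(g)` for every
total function `g` on `A` such that `a` is an index of `g` in `A[f_α]` and `F(g)` is defined;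
unions are taken at limits. -/
noncomputable def stage {A : Type u} {app : A → A → Part A} (C : Combinators app)
    (F : (A → A) → Part A) (α : Ordinal.{u}) : A → Part A :=
  Ordinal.limitRecOn (motive := fun _ => A → Part A) α
    (fun _ => Part.none)
    (fun _ fα a => theUnique fun b =>
      ∃ g : A → A, a ∈ indices (adjoin C fα) (fun x => Part.some (g x)) ∧ b ∈ F g)
    (fun l _ ih a => theUnique fun b => ∃ (β : Ordinal.{u}) (h : β < l), b ∈ ih β h a)

/-- The union of all the `f_α`. -/
noncomputable def stageUnion {A : Type u} {app : A → A → Part A} (C : Combinators app)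
    (F : (A → A) → Part A) : A → Part A :=
  fun a => theUnique fun b => ∃ α : Ordinal.{u}, b ∈ stage C F α a

/-- The application of `A[F]`. -/
noncomputable def force {A : Type u} {app : A → A → Part A} (C : Combinators app)
    (F : (A → A) → Part A) : A → A → Part A :=
  adjoin C (stageUnion C F)

/-! ### Kleene's first model -/

/-- The application `nm ≃ φₙ(m)` of Kleene's first model `K₁`. -/
def K1 : ℕ → ℕ → Part ℕ :=
  fun n m => (Nat.Partrec.Code.ofNatCode n).eval m

/-! ### Kleene computability relative to a functional -/

/-- `KleeneEval code F e ns v` says that `{e}(ns)` is defined with value `v`, where `{e}` is given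
by Kleene's schemes for computation relative to the type 2 functional `F`, and indices are formed
by the coding of tuples `code`. The second entry of an index is the number of arguments, except
in `S9`. The scheme `S7` concerns type 1 arguments, of which there are none. -/
inductive KleeneEval (code : List ℕ → ℕ) (F : (ℕ → ℕ) → ℕ) : ℕ → List ℕ → ℕ → Prop
  | S1 (n : ℕ) (ns : List ℕ) :
      KleeneEval code F (code [1, ns.length + 1]) (n :: ns) (n + 1)
  | S2 (m : ℕ) (ns : List ℕ) :
      KleeneEval code F (code [2, ns.length, m]) ns m
  | S3 (n : ℕ) (ns : List ℕ) :
      KleeneEval code F (code [3, ns.length + 1]) (n :: ns) n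
  | S4 (g h : ℕ) (ns : List ℕ) (y v : ℕ) :
      KleeneEval code F h ns y → KleeneEval code F g (y :: ns) v →
      KleeneEval code F (code [4, ns.length, g, h]) ns v
  | S5_zero (g h : ℕ) (ns : List ℕ) (v : ℕ) :
      KleeneEval code F g ns v →
      KleeneEval code F (code [5, ns.length + 1, g, h]) (0 :: ns) v
  | S5_succ (g h k : ℕ) (ns : List ℕ) (y v : ℕ) :
      KleeneEval code F (code [5, ns.length + 1, g, h]) (k :: ns) y →
      KleeneEval code F h (k :: y :: ns) v →
      KleeneEval code F (code [5, ns.length + 1, g, h]) ((k + 1) :: ns) v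
  | S6 (g : ℕ) (xs : List ℕ) (y : ℕ) (zs : List ℕ) (v : ℕ) :
      xs ≠ [] → KleeneEval code F g (y :: (xs ++ zs)) v →
      KleeneEval code F (code [6, (xs ++ y :: zs).length, xs.length, g]) (xs ++ y :: zs) v
  | S8 (h : ℕ) (ns : List ℕ) (g : ℕ → ℕ) :
      (∀ x, KleeneEval code F h (x :: ns) (g x)) →
      KleeneEval code F (code [8, ns.length, h]) ns (F g)
  | S9 (m : ℕ) (xs zs : List ℕ) (v : ℕ) :
      KleeneEval code F m xs v →
      KleeneEval code F (code [9, xs.length, zs.length]) (m :: (xs ++ zs)) v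

/-- The application `{e}(n)` of `K₁^F`. -/
noncomputable def kleeneApp (code : List ℕ → ℕ) (F : (ℕ → ℕ) → ℕ) : ℕ → ℕ → Part ℕ :=
  fun e n => theUnique (KleeneEval code F e [n])

/-- The total function `g` is computable relative to `F` in Kleene's sense. -/
def KleeneComputableIn (code : List ℕ → ℕ) (F : (ℕ → ℕ) → ℕ) (g : ℕ → ℕ) : Prop :=
  ∃ e, ∀ n, KleeneEval code F e [n] (g n)

/-! ### The partial operations above are single-valued -/

theorem KleeneEval.unique {code : List ℕ → ℕ} (hinj : Function.Injective code)
    {F : (ℕ → ℕ) → ℕ} {e : ℕ} {ns : List ℕ} {v w : ℕ}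
    (h : KleeneEval code F e ns v) (h' : KleeneEval code F e ns w) : v = w := by
  induction h generalizing w with
  | S1 n ns =>
    generalize he : code _ = e at h'
    generalize hn : n :: ns = l at h'
    cases h' <;> have := hinj he <;> simp_all
  | S2 n ns =>
    generalize he : code _ = e at h'
    cases h' <;> have := hinj he <;> simp_all
  | S3 n ns =>
    generalize he : code _ = e at h'
    generalize hn : n :: ns = l at h'
    cases h' <;> have := hinj he <;> simp_all
  | S4 g h ns y v h1 h2 ih1 ih2 =>
    generalize he : code _ = e at h'
    cases h' <;> have := hinj he <;> simp_all
    rename_i a b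
    obtain ⟨rfl, rfl⟩ := this
    obtain rfl := ih1 a
    exact ih2 b
  | S5_zero g h ns v h1 ih1 =>
    generalize he : code _ = e at h'
    generalize hn : 0 :: ns = l at h'
    cases h' <;> have := hinj he <;> simp_all
    rename_i a
    obtain ⟨rfl, rfl⟩ := this
    exact ih1 a
  | S5_succ g h k ns y v h1 h2 ih1 ih2 =>
    generalize he : code _ = e at h'
    generalize hn : (k+1) :: ns = l at h'
    cases h' <;> have := hinj he <;> simp_all
    rename_i a b
    obtain rfl := ih1 a
    exact ih2 b
  | S6 g xs y zs v hx h1 ih1 =>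
    generalize he : code _ = e at h'
    generalize hn : xs ++ y :: zs = l at h'
    cases h' <;> have := hinj he <;> simp_all
    rename_i a
    obtain ⟨rfl, h3⟩ := List.append_inj hn this.1
    simp at h3
    obtain ⟨rfl, rfl⟩ := h3
    exact ih1 a
  | S8 h ns g h1 ih1 =>
    generalize he : code _ = e at h'
    cases h' <;> have := hinj he <;> simp_all
    rename_i a
    congr 1
    funext x
    exact ih1 x (a x)
  | S9 m xs zs v h1 ih1 =>
    generalize he : code _ = e at h'
    generalize hn : m :: (xs ++ zs) = l at h'
    cases h' <;> have := hinj he <;> simp_all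
    rename_i a
    obtain ⟨rfl, h3⟩ := List.append_inj hn.2 this.1
    exact ih1 a

theorem pair_inj {A : Type u} {app : A → A → Part A} (C : Combinators app) {a b a' b' : A}
    (h : C.pair a b = C.pair a' b') : a = a' ∧ b = b' :=
  ⟨Part.mem_unique (C.p₀_app a b) (h ▸ C.p₀_app a' b'),
    Part.mem_unique (C.p₁_app a b) (h ▸ C.p₁_app a' b')⟩

theorem HaltsWith.unique {A : Type u} {app : A → A → Part A} (C : Combinators app) {f : A → Part A}
    {a b c c' : A} (h : HaltsWith C f a b c) (h' : HaltsWith C f a b c') : c = c' := by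
  by_cases hT : C.tt = C.ff
  · have := C.tt_app c c'
    rw [hT] at this
    exact Part.mem_unique this (C.ff_app c c')
  obtain ⟨u, hu, hc⟩ := h
  obtain ⟨w, hw, hc'⟩ := h'
  have key : ∀ i, i ≤ u.length → i ≤ w.length → u.take i = w.take i := by
    intro i
    induction i with
    | zero => simp
    | succ i ih =>
      intro h1 h2
      obtain ⟨x, hx, hx'⟩ := hu i h1
      obtain ⟨y, hy, hy'⟩ := hw i h2
      have e := ih (by omega) (by omega)
      rw [e] at hx
      obtain rfl := (pair_inj C (Part.mem_unique hx hy)).2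
      rw [List.take_succ_eq_append_getElem h1, List.take_succ_eq_append_getElem h2, e,
        Part.mem_unique hx' hy']
  rcases lt_trichotomy u.length w.length with hl | hl | hl
  · obtain ⟨y, hy, -⟩ := hw _ hl
    rw [← key _ le_rfl hl.le, List.take_length] at hy
    exact absurd (pair_inj C (Part.mem_unique hc hy)).1 hT
  · have := key _ le_rfl hl.le
    rw [List.take_length, hl, List.take_length] at this
    subst this
    exact (pair_inj C (Part.mem_unique hc hc')).2
  · obtain ⟨y, hy, -⟩ := hu _ hl
    rw [key _ hl.le le_rfl, List.take_length] at hy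
    exact absurd (pair_inj C (Part.mem_unique hc' hy)).1 hT

theorem mem_adjoin {A : Type u} {app : A → A → Part A} (C : Combinators app) {f : A → Part A}
    {a b c : A} : c ∈ adjoin C f a b ↔ HaltsWith C f a b c :=
  mem_theUnique.trans ⟨fun h => h.1, fun h => ⟨h, fun _ hd => hd.unique C h⟩⟩

theorem mem_kleeneApp {code : List ℕ → ℕ} (hinj : Function.Injective code)
    {F : (ℕ → ℕ) → ℕ} {e n v : ℕ} : v ∈ kleeneApp code F e n ↔ KleeneEval code F e [n] v :=
  mem_theUnique.trans ⟨fun h => h.1, fun h => ⟨h, fun _ hd => hd.unique hinj h⟩⟩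

/-! ### The stages form an increasing family of partial functions -/

theorem adjoin_mono {A : Type u} {app : A → A → Part A} (C : Combinators app) {f f' : A → Part A}
    (h : ∀ a, ∀ b ∈ f a, b ∈ f' a) {a b c : A} (hc : c ∈ adjoin C f a b) : c ∈ adjoin C f' a b := by
  rw [mem_adjoin] at *
  obtain ⟨u, hu, hc⟩ := hc
  exact ⟨u, fun i hi => let ⟨v, h1, h2⟩ := hu i hi; ⟨v, h1, h _ _ h2⟩, hc⟩

theorem stage_zero {A : Type u} {app : A → A → Part A} (C : Combinators app) (F : (A → A) → Part A) (a : A) :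
    stage C F 0 a = Part.none := by
  unfold stage; rw [Ordinal.limitRecOn_zero]

theorem mem_stage_succ {A : Type u} {app : A → A → Part A} (C : Combinators app) (F : (A → A) → Part A)
    (α : Ordinal.{u}) {a b : A} : b ∈ stage C F (Order.succ α) a ↔
      ∃ g : A → A, a ∈ indices (adjoin C (stage C F α)) (fun x => Part.some (g x)) ∧ b ∈ F g := by
  unfold stage
  rw [Order.succ_eq_add_one, Ordinal.limitRecOn_add_one]
  refine mem_theUnique.trans ⟨fun h => h.1, fun h => ⟨h, ?_⟩⟩
  rintro d ⟨g', h1, h2⟩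
  obtain ⟨g, h3, h4⟩ := h
  have : g = g' := funext fun x => Part.mem_unique (h3 x (g x) (by simp)) (h1 x (g' x) (by simp))
  subst this
  exact Part.mem_unique h2 h4

theorem mem_stage_limit_aux {A : Type u} {app : A → A → Part A} (C : Combinators app) (F : (A → A) → Part A)
    (l : Ordinal.{u}) (hl : Order.IsSuccLimit l) {a b : A} : b ∈ stage C F l a ↔
      (∃ β < l, b ∈ stage C F β a) ∧ ∀ d, (∃ β < l, d ∈ stage C F β a) → d = b := by
  unfold stage
  rw [Ordinal.limitRecOn_limit _ _ _ _ hl]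
  refine mem_theUnique.trans ?_
  simp only [exists_prop]

theorem stage_mono {A : Type u} {app : A → A → Part A} (C : Combinators app) (F : (A → A) → Part A)
    (α : Ordinal.{u}) : (∀ a, ∀ b ∈ stage C F α a, b ∈ stage C F (Order.succ α) a) ∧ 
      ∀ β ≤ α, ∀ a, ∀ b ∈ stage C F β a, b ∈ stage C F α a := by
  induction α using Ordinal.limitRecOn with
  | zero =>
    refine ⟨fun a b h => by rw [stage_zero] at h; simp at h, fun β hb a b h => ?_⟩
    rw [nonpos_iff_eq_zero] at hb; rwa [hb] at h
  | add_one α ih =>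
    rw [← Order.succ_eq_add_one]
    refine ⟨fun a b h => ?_, fun β hb a b h => ?_⟩
    · rw [mem_stage_succ] at h ⊢
      obtain ⟨g, h1, h2⟩ := h
      exact ⟨g, fun x c hc => adjoin_mono C ih.1 (h1 x c hc), h2⟩
    · rcases Order.le_succ_iff_eq_or_le.1 hb with rfl | hb
      · exact h
      · exact ih.1 _ _ (ih.2 β hb a b h)
  | limit l hl ih =>
    have key : ∀ β < l, ∀ a, ∀ b ∈ stage C F β a, b ∈ stage C F l a := by
      intro β hb a b h
      rw [mem_stage_limit_aux C F l hl]
      refine ⟨⟨β, hb, h⟩, ?_⟩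
      rintro d ⟨β', hb', h'⟩
      rcases le_total β β' with hh | hh
      · exact Part.mem_unique h' ((ih β' hb').2 β hh a b h)
      · exact Part.mem_unique ((ih β hb).2 β' hh a d h') h
    refine ⟨fun a b h => ?_, fun β hb a b h => ?_⟩
    · obtain ⟨⟨β, hb, h⟩, -⟩ := (mem_stage_limit_aux C F l hl).1 h
      have h := (ih β hb).1 _ _ h
      rw [mem_stage_succ] at h ⊢
      obtain ⟨g, h1, h2⟩ := h
      exact ⟨g, fun x c hc => adjoin_mono C (key β hb) (h1 x c hc), h2⟩
    · rcases hb.eq_or_lt with rfl | hb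
      · exact h
      · exact key β hb a b h

theorem mem_stageUnion {A : Type u} {app : A → A → Part A} (C : Combinators app) (F : (A → A) → Part A)
    {a b : A} : b ∈ stageUnion C F a ↔ ∃ α : Ordinal.{u}, b ∈ stage C F α a := by
  refine mem_theUnique.trans ⟨fun h => h.1, fun h => ⟨h, ?_⟩⟩
  rintro d ⟨β', h'⟩
  obtain ⟨β, h⟩ := h
  rcases le_total β β' with hh | hh
  · exact Part.mem_unique h' ((stage_mono C F β').2 β hh a b h)
  · exact Part.mem_unique ((stage_mono C F β).2 β' hh a d h') h

/-! ### Kleene's first model is a pca and has a choice of canonical elements -/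

theorem K1_index (f : ℕ →. ℕ) (hf : Nat.Partrec f) : ∃ e, ∀ a, K1 e a = f a := by
  obtain ⟨c, hc⟩ := Nat.Partrec.Code.exists_code.1 hf
  refine ⟨Encodable.encode c, fun a => ?_⟩
  have : Nat.Partrec.Code.ofNatCode (Encodable.encode c) = c := by
    have := Denumerable.ofNat_encode c
    exact this
  simp [K1, this, hc]

theorem K1_index2 (f : ℕ → ℕ →. ℕ) (hf : Partrec₂ f) :
    ∃ (e : ℕ) (s : ℕ → ℕ), Computable s ∧ (∀ a, K1 e a = Part.some (s a)) ∧
      ∀ a b, K1 (s a) b = f a b := by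
  obtain ⟨c, hc⟩ := Nat.Partrec.Code.exists_code.1
    (show Nat.Partrec (fun n => f n.unpair.1 n.unpair.2) from
      Partrec.nat_iff.1 (hf.comp (Computable.fst.comp Computable.unpair)
        (Computable.snd.comp Computable.unpair)))
  have hs : Computable fun a : ℕ => Encodable.encode (Nat.Partrec.Code.curry c a) :=
    Computable.encode.comp
      (Nat.Partrec.Code.primrec₂_curry.to_comp.comp (Computable.const c) Computable.id)
  obtain ⟨e, he⟩ := K1_index _ (Partrec.nat_iff.1 hs.partrec)
  refine ⟨e, _, hs, fun a => by rw [he]; rfl, fun a b => ?_⟩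
  have : Nat.Partrec.Code.ofNatCode (Encodable.encode (Nat.Partrec.Code.curry c a)) = _ :=
    Denumerable.ofNat_encode (Nat.Partrec.Code.curry c a)
  simp [K1, this, hc, Nat.Partrec.Code.eval_curry]

theorem K1_partrec : Partrec₂ K1 :=
  Nat.Partrec.Code.eval_part.comp
    ((Computable.ofNat Nat.Partrec.Code).comp Computable.fst) Computable.snd

theorem K1_index3 (f : ℕ → ℕ → ℕ →. ℕ) (hf : Partrec fun x : (ℕ × ℕ) × ℕ => f x.1.1 x.1.2 x.2) :
    ∃ (e : ℕ) , ∀ a b, ∃ d, app2 K1 e a b = Part.some d ∧ ∀ c, K1 d c = f a b c := by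
  obtain ⟨e, s, hs, he, hsf⟩ := K1_index2 (fun n c => f n.unpair.1 n.unpair.2 c)
    (Partrec.comp hf (((Computable.fst.comp Computable.unpair).pair
      (Computable.snd.comp Computable.unpair)).comp Computable.fst |>.pair Computable.snd))
  obtain ⟨e', s', hs', he', hsf'⟩ := K1_index2 (fun a b => Part.some (s (Nat.pair a b)))
    (hs.comp (Primrec₂.natPair.to_comp.comp Computable.fst Computable.snd)).partrec
  refine ⟨e', fun a b => ⟨s (Nat.pair a b), ?_, fun c => ?_⟩⟩
  · simp [app2, he', hsf']
  · simp [hsf]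

theorem K1_app2 (f : ℕ → ℕ → ℕ) (hf : Computable₂ f) : ∃ e, ∀ a b, app2 K1 e a b = Part.some (f a b) := by
  obtain ⟨e, s, -, h, h'⟩ := K1_index2 (fun a b => Part.some (f a b)) hf.partrec₂
  exact ⟨e, fun a b => by simp [app2, h, h']⟩

theorem K1_isPCA : IsPCA K1 := by
  obtain ⟨k, hk⟩ := K1_app2 (fun a _ => a) Computable.fst
  obtain ⟨s, hs⟩ := K1_index3
    (fun a b c => (K1 a c).bind fun x => (K1 b c).bind fun y => K1 x y) (by
      refine Partrec.bind (K1_partrec.comp (Computable.fst.comp Computable.fst) Computable.snd) ?_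
      refine Partrec.bind (K1_partrec.comp (Computable.snd.comp (Computable.fst.comp Computable.fst))
        (Computable.snd.comp Computable.fst)) ?_
      exact K1_partrec.comp (Computable.snd.comp Computable.fst) Computable.snd)
  refine ⟨k, s, fun a b => ?_, fun a b => by simp [hk], fun a b c v hv => ?_⟩
  · obtain ⟨d, h, -⟩ := hs a b
    simp [h]
  · obtain ⟨d, h, h'⟩ := hs a b
    simpa [app3, h, h'] using hv

theorem K1_combinators : Nonempty (Combinators K1) := by
  obtain ⟨k, s, hks⟩ := K1_isPCA
  set i := (app2 K1 s k k).get (hks.1 k k) with hi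
  have hP : Primrec₂ fun a b => Nat.pair a b + (i + 1) :=
    Primrec.nat_add.comp Primrec₂.natPair (Primrec.const (i + 1))
  have hQ : Computable fun n => (n - (i + 1)).unpair :=
    (Primrec.unpair.comp (Primrec.nat_sub.comp Primrec.id (Primrec.const (i + 1)))).to_comp
  obtain ⟨tt, htt⟩ := K1_app2 (fun a _ => a) Computable.fst
  obtain ⟨ff, hff⟩ := K1_app2 (fun _ b => b) Computable.snd
  obtain ⟨p, hp⟩ := K1_app2 _ hP.to_comp
  obtain ⟨p0, hp0⟩ := K1_index (fun n => Part.some (n - (i + 1)).unpair.1)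
    (Partrec.nat_iff.1 (Computable.fst.comp hQ).partrec)
  obtain ⟨p1, hp1⟩ := K1_index (fun n => Part.some (n - (i + 1)).unpair.2)
    (Partrec.nat_iff.1 (Computable.snd.comp hQ).partrec)
  let B : BasicCombinators K1 :=
    { k := k, s := s, isKS := hks, i := i, i_eq := Part.get_mem _,
      tt := tt, ff := ff, tt_app := fun a b => by simp [htt], ff_app := fun a b => by simp [hff],
      p := p, p₀ := p0, p₁ := p1, pair := fun a b => Nat.pair a b + (i + 1),
      p_app := fun a b => by simp [hp],
      p₀_app := fun a b => by simp [hp0], p₁_app := fun a b => by simp [hp1] }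
  have hnum : Primrec B.num := by
    have : B.num = fun n => Nat.rec i (fun _ y => Nat.pair ff y + (i + 1)) n := by
      funext n
      induction n with
      | zero => rfl
      | succ n ih => simp only [BasicCombinators.num, ih]; rfl
    rw [this]
    exact Primrec.nat_rec₁ i (hP.comp (Primrec.const ff) Primrec.snd)
  have hninj : ∀ m n, B.num m = B.num n → m = n := by
    have h0 : B.num 0 = i := rfl
    have h1 : ∀ n, B.num (n + 1) = Nat.pair ff (B.num n) + (i + 1) := fun n => rfl
    intro m
    induction m with
    | zero => rintro (_ | n) h; · rfl
              · rw [h0, h1] at h; omega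
    | succ m ih =>
      rintro (_ | n) h
      · rw [h0, h1] at h; omega
      · rw [h1, h1] at h
        have h := Nat.add_right_cancel h
        rw [ih n (Nat.pair_eq_pair.1 h).2]
  obtain ⟨sing, hsing⟩ := K1_index (fun a => Part.some (Encodable.encode [a]))
    (Partrec.nat_iff.1 (Computable.partrec
      (Primrec.encode.comp (Primrec.list_cons.comp Primrec.id (Primrec.const []))).to_comp))
  obtain ⟨cat, hcat⟩ := K1_app2
    (fun a b => Encodable.encode (Denumerable.ofNat (List ℕ) a ++ Denumerable.ofNat (List ℕ) b))
    (Primrec.encode.comp (Primrec.list_append.comp ((Primrec.ofNat _).comp Primrec.fst)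
      ((Primrec.ofNat _).comp Primrec.snd))).to_comp
  obtain ⟨len, hlen⟩ := K1_index (fun a => Part.some (B.num (Denumerable.ofNat (List ℕ) a).length))
    (Partrec.nat_iff.1 (Computable.partrec
      (hnum.comp (Primrec.list_length.comp (Primrec.ofNat _))).to_comp))
  obtain ⟨proj, sp, -, hproj, hsp⟩ := K1_index2
    (fun a b => (Nat.rfind fun m => Part.some (decide (B.num m = a))).bind fun m =>
      Part.some ((Denumerable.ofNat (List ℕ) b).getD m 0)) (by
      refine Partrec.bind (Partrec.rfind ?_) ?_
      · exact (Computable.partrec (Primrec.to_comp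
          ((Primrec.eq (α := ℕ)).comp (hnum.comp Primrec.snd)
            (Primrec.fst.comp Primrec.fst)).decide))
      · exact (Computable.partrec (Primrec.to_comp
          ((Primrec.list_getD 0).comp ((Primrec.ofNat _).comp (Primrec.snd.comp Primrec.fst))
            Primrec.snd))))
  refine ⟨{
    toBasicCombinators := B, tup := Encodable.encode, sing := sing, cat := cat, len := len,
    proj := proj, sing_app := fun a => by simp [hsing], cat_app := fun l l' => by simp [hcat],
    len_app := fun l => by simp [hlen], proj_app := fun l n a h => ?_ }⟩
  have : n ∈ Nat.rfind fun m => Part.some (decide (B.num m = B.num n)) := by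
    refine Nat.mem_rfind.2 ⟨by simp, fun {m} hm => ?_⟩
    have : B.num m ≠ B.num n := fun h => hm.ne (hninj _ _ h)
    simp [this]
  simp only [app2, hproj, Part.bind_some, hsp, Part.mem_bind_iff]
  exact ⟨n, this, by simp [h]⟩

end ForcedPCA

namespace ForcedPCA

open Encodable

/-! Both structures are least among the effective applications on `ℕ` on whose indices `F` acts, so
each simulates the other with the identity relation as carrier.

Call an application effective if it represents primitive recursive functions, composes, and has a
universal element and an internal s-m-n function. The recursion theorem then holds in it, and hence
all partial recursive functions are representable and it is a pca. `isEffective_adjoin` and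
`isEffective_kleeneApp` show that both structures are effective. `F` acts on indices in each: a
single oracle query does it in `K₁[F]`, and S8 does it in `K₁^F`.

Conversely, let `F` act on the indices of an effective application. By the recursion theorem it
contains an interpreter of Kleene's schemes (`IsEffective.exists_kleeneEval`) and an interpreter of
dialogues whose queries are answered by `F` (`IsEffective.exists_force`). Correctness is an
induction over derivations in the first case and over the stages in the second. Only defined values
have to be reproduced, so nothing is ever proved about divergence.

Applying each interpreter in the other structure gives realizers of the identity relation in both
directions. A realizer applied to an index of a total function yields an index of the same function,
which gives the last claim. -/

/-- An application on `ℕ` that computes the primitive recursive functions, is closed under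
composition, and has a universal element and an internal s-m-n function. -/
structure IsEffective (app : ℕ → ℕ → Part ℕ) : Prop where
  primrec : ∀ f : ℕ → ℕ, Nat.Primrec f → ∃ e, ∀ n, f n ∈ app e n
  bind : ∀ h : ℕ → ℕ → ℕ, Primrec₂ h → ∀ e₁ e₂, ∃ e, ∀ x, ∀ y ∈ app e₁ x,
    ∀ z ∈ app e₂ (h x y), z ∈ app e x
  univ : ∃ e, ∀ a b, ∀ c ∈ app a b, c ∈ app e (Nat.pair a b)
  smn : ∃ S : ℕ → ℕ → ℕ, (∃ e, ∀ x y, S x y ∈ app e (Nat.pair x y)) ∧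
    ∀ e x y, ∀ z ∈ app e (Nat.pair x y), z ∈ app (S e x) y

/-- The partial function `φ` between encodable types has an index. -/
def Rep (app : ℕ → ℕ → Part ℕ) {α σ : Type*} [Encodable α] [Encodable σ] (φ : α →. σ) : Prop :=
  ∃ e, ∀ a, ∀ v ∈ φ a, encode v ∈ app e (encode a)

/-! ### Recursion theory inside an effective application -/

section Closure

variable {app : ℕ → ℕ → Part ℕ} {α β σ : Type*} [Primcodable α] [Primcodable β] [Primcodable σ]

theorem Rep.mono {φ ψ : α →. σ} (h : Rep app φ) (hle : ∀ a, ∀ v ∈ ψ a, v ∈ φ a) : Rep app ψ :=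
  h.imp fun _ he a v hv => he a v (hle a v hv)

theorem IsEffective.rep_primrec (H : IsEffective app) {f : α → σ} (hf : Primrec f) :
    Rep app (fun a => Part.some (f a)) := by
  -- Primitive recursiveness between encoded types is stated through codes of `Option` values, where
  -- `some` shifts by one; `pred` undoes the shift.
  obtain ⟨e, he⟩ := H.primrec _ (Nat.Primrec.pred.comp hf)
  refine ⟨e, fun a v hv => ?_⟩
  obtain rfl := Part.mem_some_iff.1 hv
  simpa using he (encode a)

theorem IsEffective.rep_comp (H : IsEffective app) {φ : α →. β} {ψ : β →. σ}
    (hφ : Rep app φ) (hψ : Rep app ψ) : Rep app (fun a => (φ a).bind ψ) := by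
  obtain ⟨e₁, h₁⟩ := hφ
  obtain ⟨e₂, h₂⟩ := hψ
  obtain ⟨e, he⟩ := H.bind (fun _ y => y) Primrec₂.right e₁ e₂
  refine ⟨e, fun a v hv => ?_⟩
  obtain ⟨y, hy, hv⟩ := Part.mem_bind_iff.1 hv
  exact he _ _ (h₁ a y hy) _ (h₂ y v hv)

theorem IsEffective.rep_bind (H : IsEffective app) {φ : α →. β} {ψ : α → β →. σ}
    (hφ : Rep app φ) (hψ : Rep app fun p : α × β => ψ p.1 p.2) :
    Rep app (fun a => (φ a).bind (ψ a)) := by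
  obtain ⟨e₁, h₁⟩ := hφ
  obtain ⟨e₂, h₂⟩ := hψ
  obtain ⟨e, he⟩ := H.bind Nat.pair Primrec₂.natPair e₁ e₂
  refine ⟨e, fun a v hv => ?_⟩
  obtain ⟨y, hy, hv⟩ := Part.mem_bind_iff.1 hv
  exact he _ _ (h₁ a y hy) _ (h₂ (a, y) v hv)

theorem IsEffective.rep_comp_primrec (H : IsEffective app) {f : α → β} {ψ : β →. σ}
    (hψ : Rep app ψ) (hf : Primrec f) : Rep app (fun a => ψ (f a)) :=
  (H.rep_comp (H.rep_primrec hf) hψ).mono fun _ _ hv =>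
    Part.mem_bind (Part.mem_some _) hv

theorem IsEffective.rep_app (H : IsEffective app) :
    Rep app (fun p : ℕ × ℕ => app p.1 p.2) := by
  obtain ⟨e, he⟩ := H.univ
  exact ⟨e, fun a v hv => he _ _ _ hv⟩

theorem IsEffective.rep_run (H : IsEffective app) {f g : α → ℕ} (hf : Primrec f)
    (hg : Primrec g) : Rep app (fun a => app (f a) (g a)) :=
  H.rep_comp_primrec (f := fun a => (f a, g a)) H.rep_app (hf.pair hg)

/-- The test selects an index and only the selected index is run, so the other branch may diverge.
-/
theorem IsEffective.rep_cond (H : IsEffective app) {c : α → Bool} {φ ψ : α →. σ}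
    (hc : Primrec c) (hφ : Rep app φ) (hψ : Rep app ψ) :
    Rep app (fun a => cond (c a) (φ a) (ψ a)) := by
  obtain ⟨e₁, h₁⟩ := hφ
  obtain ⟨e₂, h₂⟩ := hψ
  obtain ⟨e, he⟩ := H.rep_run (Primrec.cond hc (Primrec.const e₁) (Primrec.const e₂))
    (Primrec.encode (α := α))
  refine ⟨e, fun a v hv => he a _ ?_⟩
  cases h : c a <;> simp only [h, cond_true, cond_false] at hv ⊢
  exacts [h₂ a v hv, h₁ a v hv]

theorem IsEffective.rep_curry (H : IsEffective app) {φ : α × β →. σ} (hφ : Rep app φ) :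
    ∃ t : α → ℕ, Rep app (fun a => Part.some (t a)) ∧
      ∀ a b, ∀ v ∈ φ (a, b), encode v ∈ app (t a) (encode b) := by
  obtain ⟨S, ⟨s, hs⟩, hS⟩ := H.smn
  obtain ⟨e, he⟩ := hφ
  refine ⟨fun a => S e (encode a), ?_, fun a b v hv => hS _ _ _ _ (he (a, b) v hv)⟩
  have : Rep app (fun p : ℕ × ℕ => Part.some (S p.1 p.2)) :=
    ⟨s, fun a v hv => by obtain rfl := Part.mem_some_iff.1 hv; exact hs _ _⟩
  exact H.rep_comp_primrec (f := fun a : α => (e, encode a)) this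
    ((Primrec.const e).pair Primrec.encode)

/-- The recursion theorem. -/
theorem IsEffective.rep_fix (H : IsEffective app) {φ : ℕ × α →. σ} (hφ : Rep app φ) :
    ∃ e, ∀ a, ∀ v ∈ φ (e, a), encode v ∈ app e (encode a) := by
  obtain ⟨S, ⟨s, hs⟩, hS⟩ := H.smn
  have h1 : Rep app (fun p : ℕ × ℕ => Part.some (S p.1 p.2)) :=
    ⟨s, fun a v hv => by obtain rfl := Part.mem_some_iff.1 hv; exact hs _ _⟩
  -- Diagonalisation: if `d` represents this map, then `S d d` is the fixed point.
  have h2 : Rep app fun p : ℕ × α => (Part.some (S p.1 p.1)).bind fun e => φ (e, p.2) := by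
    refine H.rep_bind (H.rep_comp_primrec (f := fun p : ℕ × α => (p.1, p.1)) h1
      (Primrec.fst.pair Primrec.fst)) ?_
    exact H.rep_comp_primrec (f := fun q : (ℕ × α) × ℕ => (q.2, q.1.2)) hφ
      (Primrec.snd.pair (Primrec.snd.comp Primrec.fst))
  obtain ⟨d, hd⟩ := h2
  exact ⟨S d d, fun a v hv => hS _ _ _ _ (hd (d, a) v (by simpa using hv))⟩

/-- Unbounded search comes from the recursion theorem: a self-calling index raises the step bound of
the primitive recursive `evaln` until it returns a value. -/
theorem IsEffective.rep_partrec (H : IsEffective app) {φ : α →. σ} (hφ : Partrec φ) :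
    Rep app φ := by
  obtain ⟨c, hc⟩ := Nat.Partrec.Code.exists_code.1 hφ
  have hev : Primrec fun p : ℕ × ℕ × ℕ => Nat.Partrec.Code.evaln p.2.2 c p.2.1 :=
    Nat.Partrec.Code.primrec_evaln.comp
      (((Primrec.snd.comp Primrec.snd).pair (Primrec.const c)).pair
        (Primrec.fst.comp Primrec.snd))
  obtain ⟨e, he⟩ := H.rep_fix (φ := fun p : ℕ × ℕ × ℕ =>
      cond (Nat.Partrec.Code.evaln p.2.2 c p.2.1).isSome
        (Part.some ((Nat.Partrec.Code.evaln p.2.2 c p.2.1).getD 0))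
        (app p.1 (encode (p.2.1, p.2.2 + 1)))) (by
    refine H.rep_cond (Primrec.option_isSome.comp hev)
      (H.rep_primrec (Primrec.option_getD.comp hev (Primrec.const 0)))
      (H.rep_run Primrec.fst (Primrec.encode.comp
        ((Primrec.fst.comp Primrec.snd).pair (Primrec.succ.comp (Primrec.snd.comp Primrec.snd))))))
  -- Induction on the distance `i` from the current bound `j` to a bound `k` that suffices; an
  -- earlier success gives the same value by soundness.
  have key : ∀ n v k, v ∈ Nat.Partrec.Code.evaln k c n → ∀ i j, j + i = k →
      v ∈ app e (encode (n, j)) := by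
    intro n v k hk i
    induction i with
    | zero =>
      rintro j rfl
      refine he (n, j) v ?_
      rw [Option.mem_def, Nat.add_zero] at hk
      simp [hk]
    | succ i ih =>
      intro j hj
      refine he (n, j) v ?_
      cases hjv : Nat.Partrec.Code.evaln j c n with
      | none => simpa [hjv] using ih (j + 1) (by omega)
      | some w =>
        have : v = w := Part.mem_unique (Nat.Partrec.Code.evaln_sound hk)
          (Nat.Partrec.Code.evaln_sound (Option.mem_def.2 hjv))
        simp [this]
  obtain ⟨e', he'⟩ := H.rep_run (app := app) (f := fun _ : α => e)
    (g := fun a : α => encode (encode a, 0)) (Primrec.const e)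
    (Primrec.encode.comp (Primrec.encode.pair (Primrec.const 0)))
  refine ⟨e', fun a v hv => he' a (encode v) ?_⟩
  have : encode v ∈ c.eval (encode a) := by
    rw [hc]; simpa using hv
  obtain ⟨k, hk⟩ := Nat.Partrec.Code.evaln_complete.1 this
  exact key _ _ k hk k 0 (by simp)

theorem IsEffective.exists_app2 (H : IsEffective app) {φ : ℕ × ℕ →. ℕ} (hφ : Rep app φ) :
    ∃ r, ∀ a b, ∀ v ∈ φ (a, b), v ∈ app2 app r a b := by
  obtain ⟨t, ⟨r, hr⟩, ht⟩ := H.rep_curry hφ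
  exact ⟨r, fun a b v hv => Part.mem_bind (hr a _ (Part.mem_some _)) (ht a b v hv)⟩

theorem IsEffective.isPCA (H : IsEffective app) : IsPCA app := by
  obtain ⟨k, hk⟩ := H.exists_app2 (φ := fun p => Part.some p.1) (H.rep_primrec Primrec.fst)
  have h1 : Rep app fun q : (ℕ × ℕ) × ℕ =>
      (app q.1.1 q.2).bind fun x => (app q.1.2 q.2).bind fun y => app x y := by
    refine H.rep_bind (H.rep_run (Primrec.fst.comp Primrec.fst) Primrec.snd) ?_
    refine H.rep_bind (H.rep_run (Primrec.snd.comp (Primrec.fst.comp Primrec.fst))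
      (Primrec.snd.comp Primrec.fst)) ?_
    exact H.rep_run (Primrec.snd.comp Primrec.fst) Primrec.snd
  obtain ⟨t, ht, ht'⟩ := H.rep_curry h1
  obtain ⟨s, hs⟩ := H.exists_app2 ht
  refine ⟨k, s, fun a b => ?_, fun a b => hk a b a (Part.mem_some _), fun a b c v hv => ?_⟩
  · exact Part.dom_iff_mem.2 ⟨_, hs a b _ (Part.mem_some _)⟩
  · exact Part.mem_bind (hs a b _ (Part.mem_some _)) (ht' (a, b) c v hv)

end Closure

/-! ### Dialogues as partial recursive strategies on lists -/

section Adjoin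

variable (C : Combinators K1)

theorem K1_app2_partrec {α : Type*} [Primcodable α] {f g h : α → ℕ} (hf : Computable f)
    (hg : Computable g) (hh : Computable h) : Partrec fun a => app2 K1 (f a) (g a) (h a) :=
  (K1_partrec.comp hf hg).bind (K1_partrec.comp Computable.snd (hh.comp Computable.fst))

theorem computable_pair : Computable₂ C.pair :=
  (K1_app2_partrec (Computable.const C.p) Computable.fst Computable.snd).of_eq_tot
    fun _ => C.p_app _ _

theorem computable_num : Computable C.num := by
  have : Computable fun n : ℕ => (Nat.rec C.i (fun _ y => C.pair C.ff y) n : ℕ) :=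
    Computable.nat_rec Computable.id (Computable.const C.i)
      ((computable_pair C).comp (Computable.const C.ff)
        (Computable.snd.comp Computable.snd)).to₂
  refine this.of_eq fun n => ?_
  induction n with
  | zero => rfl
  | succ n ih => simp only [BasicCombinators.num, ← ih]

/-- Curry numerals are distinct, since projections out of tuples tell them apart. -/
theorem num_injective : Function.Injective C.num := by
  intro m n h
  have hm := C.proj_app (List.range (m + n + 1)) m m (by simp)
  have hn := C.proj_app (List.range (m + n + 1)) n n (by simp)
  rw [h] at hm
  exact Part.mem_unique hm hn

/-- The coding of tuples is arbitrary, but a code can be assembled from the constant `C.tup []` by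
appending singletons with `C.cat`. -/
theorem computable_tup : Computable C.tup := by
  have h : Partrec fun l : List ℕ => (Nat.rec (Part.some (C.tup []))
      (fun i IH => IH.bind fun t => (K1 C.sing (l.getD i 0)).bind fun x => app2 K1 C.cat t x)
        l.length : Part ℕ) := by
    refine Partrec.nat_rec (f := List.length) (g := fun _ => Part.some (C.tup []))
      (h := fun (l : List ℕ) (p : ℕ × ℕ) =>
        (K1 C.sing (l.getD p.1 0)).bind fun x => app2 K1 C.cat p.2 x)
      Computable.list_length (Computable.const _).partrec ?_
    refine Partrec.bind (K1_partrec.comp (Computable.const C.sing)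
      ((Primrec.list_getD 0).to_comp.comp Computable.fst
        (Computable.fst.comp Computable.snd))) ?_
    exact K1_app2_partrec (Computable.const C.cat)
      (Computable.snd.comp (Computable.snd.comp Computable.fst)) Computable.snd
  refine h.of_eq_tot fun l => ?_
  have key : ∀ n ≤ l.length, C.tup (l.take n) ∈ (Nat.rec (Part.some (C.tup []))
      (fun i IH => IH.bind fun t => (K1 C.sing (l.getD i 0)).bind fun x => app2 K1 C.cat t x)
        n : Part ℕ) := by
    intro n
    induction n with
    | zero => intro _; exact Part.mem_some _
    | succ n ih =>
      intro hn
      refine Part.mem_bind (ih (by omega)) (Part.mem_bind (C.sing_app _) ?_)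
      have := C.cat_app (l.take n) [l.getD n 0]
      rwa [show l.take n ++ [l.getD n 0] = l.take (n + 1) by
        rw [List.take_succ_eq_append_getElem hn, List.getD_eq_getElem _ _ hn]] at this
  simpa using key l.length le_rfl

/-- The length arrives as a Curry numeral; a search, correct by `num_injective`, turns it into a
number, and the entries are then projected out one by one. -/
theorem exists_untup : ∃ d : ℕ →. List ℕ, Partrec d ∧ ∀ l, l ∈ d (C.tup l) := by
  have hp : Partrec fun z : ℕ => (K1 C.len z).bind fun n =>
      (Nat.rfind fun m => Part.some (decide (C.num m = n))).bind fun m =>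
        (Nat.rec (Part.some []) (fun i IH => IH.bind fun l =>
          (app2 K1 C.proj (C.num i) z).map fun a => l ++ [a]) m : Part (List ℕ)) := by
    refine Partrec.bind (K1_partrec.comp (Computable.const C.len) Computable.id) ?_
    refine Partrec.bind (Partrec.rfind ?_) ?_
    · exact ((Primrec.eq (α := ℕ)).decide.to_comp.comp ((computable_num C).comp Computable.snd)
        (Computable.snd.comp Computable.fst)).partrec
    · refine Partrec.nat_rec (f := fun q : (ℕ × ℕ) × ℕ => q.2) (g := fun _ => Part.some [])
        (h := fun (q : (ℕ × ℕ) × ℕ) (p : ℕ × List ℕ) =>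
          (app2 K1 C.proj (C.num p.1) q.1.1).map fun a => p.2 ++ [a])
        Computable.snd (Computable.const _).partrec ?_
      refine Partrec.map (K1_app2_partrec (Computable.const _)
        ((computable_num C).comp (Computable.fst.comp Computable.snd))
        (Computable.fst.comp (Computable.fst.comp Computable.fst))) ?_
      exact Computable.list_append.comp
        (Computable.snd.comp (Computable.snd.comp Computable.fst))
        (Computable.list_cons.comp Computable.snd (Computable.const []))
  refine ⟨_, hp, fun l => Part.mem_bind (C.len_app l) (Part.mem_bind (a := l.length) ?_ ?_)⟩
  · refine Nat.mem_rfind.2 ⟨by simp, fun {m} hm => ?_⟩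
    simp [(num_injective C).ne hm.ne]
  · have key : ∀ n ≤ l.length, l.take n ∈ (Nat.rec (Part.some []) (fun i IH => IH.bind fun l' =>
          (app2 K1 C.proj (C.num i) (C.tup l)).map fun a => l' ++ [a]) n : Part (List ℕ)) := by
      intro n
      induction n with
      | zero => intro _; simp
      | succ n ih =>
        intro hn
        refine Part.mem_bind (ih (by omega)) ?_
        rw [List.take_succ_eq_append_getElem hn]
        exact Part.mem_map (fun a => l.take n ++ [a])
          (C.proj_app l n l[n] (List.getElem?_eq_getElem hn))
    simpa using key l.length le_rfl

/-- A reply in a dialogue: `inl v` queries the oracle at `v`, `inr c` halts with result `c`. -/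
def reply : ℕ ⊕ ℕ → ℕ := Sum.elim (C.pair C.ff) (C.pair C.tt)

theorem tt_ne_ff : C.tt ≠ C.ff := by
  intro h
  have := C.tt_app 0 1
  rw [h] at this
  exact absurd (Part.mem_unique this (C.ff_app 0 1)) (by decide)

/-- The strategies played by the elements of `K₁` in dialogues are uniformly partial recursive. -/
theorem exists_strategy : ∃ run : ℕ → List ℕ →. ℕ ⊕ ℕ, Partrec₂ run ∧
    ∀ e l r, reply C r ∈ K1 e (C.tup l) → r ∈ run e l := by
  refine ⟨fun e l => (K1 e (C.tup l)).bind fun z => (K1 C.p₀ z).bind fun t =>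
    (K1 C.p₁ z).map fun v => cond (decide (t = C.ff)) (Sum.inl v) (Sum.inr v), ?_, ?_⟩
  · refine Partrec.bind (K1_partrec.comp Computable.fst
      ((computable_tup C).comp Computable.snd)) ?_
    refine Partrec.bind (K1_partrec.comp (Computable.const _) Computable.snd) ?_
    refine Partrec.map (K1_partrec.comp (Computable.const _)
      (Computable.snd.comp Computable.fst)) ?_
    exact Computable.cond ((Primrec.eq (α := ℕ)).decide.to_comp.comp
      (Computable.snd.comp Computable.fst) (Computable.const _))
      (Computable.sumInl.comp Computable.snd) (Computable.sumInr.comp Computable.snd)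
  · rintro e l (v | v) h
    · refine Part.mem_bind h (Part.mem_bind (C.p₀_app C.ff v) ?_)
      simpa [reply] using C.p₁_app C.ff v
    · refine Part.mem_bind h (Part.mem_bind (C.p₀_app C.tt v) ?_)
      simpa [reply, tt_ne_ff C] using C.p₁_app C.tt v

/-- Every partial recursive strategy is played by an element of `K₁`. -/
theorem exists_player {φ : ℕ → List ℕ →. ℕ ⊕ ℕ} (hφ : Partrec₂ φ) :
    ∃ S : ℕ → ℕ, Computable S ∧ ∀ p l, ∀ r ∈ φ p l, reply C r ∈ K1 (S p) (C.tup l) := by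
  obtain ⟨d, hd, hd'⟩ := exists_untup C
  have hr : Computable (reply C) :=
    (Computable.sumCasesOn Computable.id
      ((computable_pair C).comp (Computable.const C.ff) Computable.snd).to₂
      ((computable_pair C).comp (Computable.const C.tt) Computable.snd).to₂).of_eq
      fun r => by cases r <;> rfl
  obtain ⟨-, S, hS, -, h⟩ := K1_index2 (fun p z => (d z).bind fun l => (φ p l).map (reply C))
    (Partrec.bind (hd.comp Computable.snd)
      (Partrec.map (hφ.comp (Computable.fst.comp Computable.fst) Computable.snd)
        (hr.comp Computable.snd)))
  refine ⟨S, hS, fun p l r hr => ?_⟩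
  rw [h]
  exact Part.mem_bind (hd' l) (Part.mem_map _ hr)

/-- The strategy `φ`, with oracle `f`, started at `b`, halts with result `c`. -/
def Plays (f : ℕ → Part ℕ) (φ : List ℕ →. ℕ ⊕ ℕ) (b c : ℕ) : Prop :=
  ∃ u : List ℕ, (∀ (i : ℕ) (hi : i < u.length), ∃ v, Sum.inl v ∈ φ (b :: u.take i) ∧ u[i] ∈ f v) ∧
    Sum.inr c ∈ φ (b :: u)

theorem plays_of_mem_adjoin {f : ℕ → Part ℕ} {run : ℕ → List ℕ →. ℕ ⊕ ℕ}
    (hrun : ∀ e l r, reply C r ∈ K1 e (C.tup l) → r ∈ run e l) {a b c : ℕ}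
    (h : c ∈ adjoin C f a b) : Plays f (run a) b c := by
  obtain ⟨u, hu, hc⟩ := (mem_adjoin C).1 h
  exact ⟨u, fun i hi => (hu i hi).imp fun v hv => ⟨hrun _ _ (Sum.inl v) hv.1, hv.2⟩,
    hrun _ _ (Sum.inr c) hc⟩

/-- Replaces the coding of tuples and replies by strategies on plain lists. The element `S p` does
not depend on the oracle, and computability of `S` is what yields the s-m-n function. -/
theorem exists_adjoin_of_plays {φ : ℕ → List ℕ →. ℕ ⊕ ℕ} (hφ : Partrec₂ φ) :
    ∃ S : ℕ → ℕ, Computable S ∧ ∀ f p b c, Plays f (φ p) b c → c ∈ adjoin C f (S p) b := by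
  obtain ⟨S, hS, h⟩ := exists_player C hφ
  refine ⟨S, hS, fun f p b c ⟨u, hu, hc⟩ => (mem_adjoin C).2 ⟨u, fun i hi => ?_, ?_⟩⟩
  · exact (hu i hi).imp fun v hv => ⟨h p _ (Sum.inl v) hv.1, hv.2⟩
  · exact h p _ (Sum.inr c) hc

theorem adjoin_computable {g : ℕ → ℕ} (hg : Computable g) (f : ℕ → Part ℕ) :
    ∃ e, ∀ n, g n ∈ adjoin C f e n := by
  obtain ⟨S, -, hS⟩ := exists_adjoin_of_plays C
    (φ := fun _ l => Part.some (Sum.inr (g l.headI)))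
    (Computable.sumInr.comp (hg.comp (Primrec.list_headI.to_comp.comp Computable.snd)))
  exact ⟨S 0, fun n => hS f 0 n _ ⟨[], by simp, by simp⟩⟩

theorem adjoin_query (f : ℕ → Part ℕ) : ∃ q, ∀ v, ∀ w ∈ f v, w ∈ adjoin C f q v := by
  -- A list of length 1 holds just the input, which is queried; a second entry is the oracle's
  -- answer, which is returned.
  obtain ⟨S, -, hS⟩ := exists_adjoin_of_plays C (φ := fun _ l => Part.some
      (cond (decide (l.length = 1)) (Sum.inl l.headI) (Sum.inr l.tail.headI))) (by
    refine Primrec.to_comp (Primrec.cond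
      ((Primrec.eq (α := ℕ)).decide.comp (Primrec.list_length.comp Primrec.snd) (Primrec.const 1))
      (Primrec.sumInl.comp (Primrec.list_headI.comp Primrec.snd))
      (Primrec.sumInr.comp (Primrec.list_headI.comp (Primrec.list_tail.comp Primrec.snd))))
      |>.partrec)
  exact ⟨S 0, fun v w hw => hS f 0 v w ⟨[w], by simpa using hw, by simp⟩⟩

/-- Follow the strategy `φ` until it halts with a result `y`, then follow `ψ` started
at `h b y`. -/
def seqStrategy (h : ℕ → ℕ → ℕ) (φ ψ : List ℕ →. ℕ ⊕ ℕ) (l : List ℕ) : Part (ℕ ⊕ ℕ) :=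
  -- A strategy sees only the list of answers, so `φ` is replayed to the least `i` at which it halts
  -- or the answers run out. If it has halted, the answers from `i` on belong to `ψ`.
  (Nat.rfind fun i => (φ (l.headI :: l.tail.take i)).map fun r =>
      r.isRight || decide (l.tail.length ≤ i)).bind fun i =>
    (φ (l.headI :: l.tail.take i)).bind fun r =>
      Sum.casesOn r (fun v => Part.some (Sum.inl v))
        fun y => ψ (h l.headI y :: l.tail.drop i)

theorem partrec_seqStrategy {h : ℕ → ℕ → ℕ} {φ ψ : List ℕ →. ℕ ⊕ ℕ} (hh : Computable₂ h)
    (hφ : Partrec φ) (hψ : Partrec ψ) : Partrec (seqStrategy h φ ψ) := by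
  have hl : Computable fun p : List ℕ × ℕ => p.1.headI :: p.1.tail.take p.2 :=
    Computable.list_cons.comp (Primrec.list_headI.to_comp.comp Computable.fst)
      (Primrec.list_take.to_comp.comp Computable.snd
        (Primrec.list_tail.to_comp.comp Computable.fst))
  refine Partrec.bind (Partrec.rfind (Partrec.map (hφ.comp hl) ?_)) ?_
  · refine Primrec.to_comp (Primrec.or.comp ?_ ?_)
    · exact (Primrec.sumCasesOn Primrec.snd (Primrec.const false).to₂
        (Primrec.const true).to₂).of_eq fun p => by rcases p with ⟨_, _ | _⟩ <;> rfl
    · exact Primrec.nat_le.decide.comp (Primrec.list_length.comp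
        (Primrec.list_tail.comp (Primrec.fst.comp Primrec.fst)))
        (Primrec.snd.comp Primrec.fst)
  · refine Partrec.bind (hφ.comp hl) ?_
    refine Partrec.sumCasesOn_right Computable.snd
      (Computable.sumInl.comp Computable.snd) (hψ.comp ?_)
    refine Computable.list_cons.comp (hh.comp (Primrec.list_headI.to_comp.comp
      (Computable.fst.comp (Computable.fst.comp Computable.fst))) Computable.snd) ?_
    exact Primrec.list_drop.to_comp.comp (Computable.snd.comp (Computable.fst.comp Computable.fst))
      (Primrec.list_tail.to_comp.comp (Computable.fst.comp (Computable.fst.comp Computable.fst)))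

theorem mem_seqStrategy {h : ℕ → ℕ → ℕ} {φ ψ : List ℕ →. ℕ ⊕ ℕ} {b : ℕ} {u : List ℕ} {k : ℕ}
    {r s : ℕ ⊕ ℕ} (hk : ∀ i < k, i < u.length ∧ ∃ v, Sum.inl v ∈ φ (b :: u.take i))
    (hr : r ∈ φ (b :: u.take k)) (hend : r.isRight ∨ u.length ≤ k)
    (hs : s ∈ (Sum.casesOn r (fun v => Part.some (Sum.inl v))
        fun y => ψ (h b y :: u.drop k) : Part (ℕ ⊕ ℕ))) :
    s ∈ seqStrategy h φ ψ (b :: u) := by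
  refine Part.mem_bind (a := k) (Nat.mem_rfind.2 ⟨?_, fun {i} hi => ?_⟩) (Part.mem_bind hr hs)
  · refine (Part.mem_map_iff _).2 ⟨r, hr, ?_⟩
    rcases hend with hend | hend <;> simp [hend]
  · obtain ⟨hi', v, hv⟩ := hk i hi
    exact (Part.mem_map_iff _).2 ⟨_, hv, decide_eq_false (not_le.2 hi')⟩

theorem Plays.seq {f : ℕ → Part ℕ} {h : ℕ → ℕ → ℕ} {φ ψ : List ℕ →. ℕ ⊕ ℕ} {x y z : ℕ}
    (hφ : Plays f φ x y) (hψ : Plays f ψ (h x y) z) : Plays f (seqStrategy h φ ψ) x z := by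
  obtain ⟨u, hu, hy⟩ := hφ
  obtain ⟨w, hw, hz⟩ := hψ
  -- Once the answers `u` have been consumed, the composite strategy plays as `ψ` does.
  have second : ∀ t s, s ∈ ψ (h x y :: t) → s ∈ seqStrategy h φ ψ (x :: (u ++ t)) := by
    intro t s hs
    refine mem_seqStrategy (k := u.length) (r := Sum.inr y) (fun i hi => ⟨by simp; omega, ?_⟩)
      (by simpa using hy) (Or.inl rfl) (by simpa using hs)
    obtain ⟨v, hv, -⟩ := hu i hi
    exact ⟨v, by rwa [List.take_append_of_le_length hi.le]⟩
  refine ⟨u ++ w, fun i hi => ?_, second w _ hz⟩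
  rcases lt_or_ge i u.length with hiu | hiu
  · obtain ⟨v, hv, hv'⟩ := hu i hiu
    refine ⟨v, mem_seqStrategy (k := i) (r := Sum.inl v) (fun j hj => ⟨?_, ?_⟩) ?_
      (Or.inr ?_) (by simp), by rwa [List.getElem_append_left hiu]⟩
    · simp; omega
    · obtain ⟨v', hv', -⟩ := hu j (hj.trans hiu)
      refine ⟨v', ?_⟩
      rwa [List.take_take, min_eq_left hj.le, List.take_append_of_le_length (hj.trans hiu).le]
    · rwa [List.take_take, min_self, List.take_append_of_le_length hiu.le]
    · simp
  · obtain ⟨v, hv, hv'⟩ := hw (i - u.length) (by simp at hi; omega)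
    refine ⟨v, ?_, by rwa [List.getElem_append_right hiu]⟩
    rw [List.take_append, List.take_of_length_le hiu]
    exact second _ _ hv

theorem isEffective_adjoin (f : ℕ → Part ℕ) : IsEffective (adjoin C f) := by
  obtain ⟨run, hrun, hrun'⟩ := exists_strategy C
  have hplays : ∀ {a b c}, c ∈ adjoin C f a b → Plays f (run a) b c :=
    plays_of_mem_adjoin C hrun'
  have hhead : Computable fun p : ℕ × List ℕ => p.2.headI :=
    Primrec.list_headI.to_comp.comp Computable.snd
  have htail : Computable fun p : ℕ × List ℕ => p.2.tail :=
    Primrec.list_tail.to_comp.comp Computable.snd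
  refine ⟨fun g hg => adjoin_computable C (Primrec.nat_iff.2 hg).to_comp f,
    fun h hh e₁ e₂ => ?_, ?_, ?_⟩
  · obtain ⟨S, -, hS⟩ := exists_adjoin_of_plays C
      (φ := fun _ => seqStrategy h (run e₁) (run e₂))
      ((partrec_seqStrategy hh.to_comp (hrun.comp (Computable.const _) Computable.id)
        (hrun.comp (Computable.const _) Computable.id)).comp Computable.snd)
    exact ⟨S 0, fun x y hy z hz => hS f 0 x z ((hplays hy).seq (hplays hz))⟩
  · obtain ⟨S, -, hS⟩ := exists_adjoin_of_plays C
      (φ := fun _ l => run l.headI.unpair.1 (l.headI.unpair.2 :: l.tail))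
      (hrun.comp (Computable.fst.comp (Computable.unpair.comp hhead))
        (Computable.list_cons.comp (Computable.snd.comp (Computable.unpair.comp hhead)) htail))
    refine ⟨S 0, fun a b c hc => hS f 0 _ c ?_⟩
    simpa [Plays] using hplays hc
  · obtain ⟨S, hS, hS'⟩ := exists_adjoin_of_plays C
      (φ := fun p l => run p.unpair.1 (Nat.pair p.unpair.2 l.headI :: l.tail))
      (hrun.comp (Computable.fst.comp (Computable.unpair.comp Computable.fst))
        (Computable.list_cons.comp (Primrec₂.natPair.to_comp.comp
          (Computable.snd.comp (Computable.unpair.comp Computable.fst)) hhead) htail))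
    obtain ⟨s, hs⟩ := adjoin_computable C hS f
    refine ⟨fun e x => S (Nat.pair e x), ⟨s, fun x y => hs _⟩, fun e x y z hz => hS' f _ y z ?_⟩
    simpa [Plays] using hplays hz

end Adjoin

/-! ### The union of the stages as a least fixed point -/

/-- The dialogues computing all values of `g` make countably many queries in total. The supremum of
the stages answering them is an ordinal at which `a` already indexes `g`, so `F g` appears at its
successor. -/
theorem stageUnion_of_index {C : Combinators K1} {F : (ℕ → ℕ) → Part ℕ} {a b : ℕ} {g : ℕ → ℕ}
    (hg : ∀ x, g x ∈ force C F a x) (hb : b ∈ F g) : b ∈ stageUnion C F a := by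
  choose u hu hc using fun x => (mem_adjoin C).1 (hg x)
  choose v hv hv' using hu
  choose α hα using fun x i hi => (mem_stageUnion C F).1 (hv' x i hi)
  let α' : (Σ x, Fin (u x).length) → Ordinal.{0} := fun p => α p.1 p.2 p.2.2
  refine (mem_stageUnion C F).2 ⟨Order.succ (⨆ p, α' p), (mem_stage_succ C F _).2 ⟨g, ?_, hb⟩⟩
  intro x c hcx
  obtain rfl := Part.mem_some_iff.1 hcx
  refine (mem_adjoin C).2 ⟨u x, fun i hi => ⟨v x i hi, hv x i hi, ?_⟩, hc x⟩
  exact (stage_mono C F _).2 _ (Ordinal.le_iSup α' ⟨x, i, hi⟩) _ _ (hα x i hi)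

/-- Leastness of the union. The oracle in `step` is any `f` satisfying `P`, so that ordinals
disappear from later arguments. -/
theorem stageUnion_induction {C : Combinators K1} {F : (ℕ → ℕ) → Part ℕ}
    {P : ℕ → ℕ → Prop}
    (step : ∀ (f : ℕ → Part ℕ) a g b, (∀ v, ∀ w ∈ f v, P v w) → (∀ x, g x ∈ adjoin C f a x) →
      b ∈ F g → P a b) {a b : ℕ} (h : b ∈ stageUnion C F a) : P a b := by
  rw [mem_stageUnion] at h
  obtain ⟨α, h⟩ := h
  induction α using Ordinal.limitRecOn generalizing a b with
  | zero => rw [stage_zero] at h; simp at h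
  | add_one α ih =>
    rw [← Order.succ_eq_add_one, mem_stage_succ] at h
    obtain ⟨g, hg, hb⟩ := h
    exact step _ a g b (fun v w hw => ih hw) (fun x => hg x _ (Part.mem_some _)) hb
  | limit l hl ih =>
    obtain ⟨⟨β, hβ, h⟩, -⟩ := (mem_stage_limit_aux C F l hl).1 h
    exact ih β hβ h

/-! ### Programming with Kleene's schemes -/

namespace KleeneEval

variable {code : List ℕ → ℕ} {F : (ℕ → ℕ) → ℕ}

theorem const {n : ℕ} {ns : List ℕ} (hn : ns.length = n) (m : ℕ) :
    KleeneEval code F (code [2, n, m]) ns m := hn ▸ S2 m ns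

theorem comp {n g h y v : ℕ} {ns : List ℕ} (hn : ns.length = n) (h₁ : KleeneEval code F h ns y)
    (h₂ : KleeneEval code F g (y :: ns) v) : KleeneEval code F (code [4, n, g, h]) ns v :=
  hn ▸ S4 g h ns y v h₁ h₂

theorem call {k l m v : ℕ} {xs zs : List ℕ} (hk : xs.length = k) (hl : zs.length = l)
    (h : KleeneEval code F m xs v) : KleeneEval code F (code [9, k, l]) (m :: (xs ++ zs)) v :=
  hk ▸ hl ▸ S9 m xs zs v h

end KleeneEval

/-- An index that applies `{e}` to the first `k` of `k + l` arguments. -/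
def padIndex (code : List ℕ → ℕ) (k l e : ℕ) : ℕ :=
  code [4, k + l, code [9, k, l], code [2, k + l, e]]

/-- An index that moves the `k`-th of `r` arguments to the front before applying `{e}`. -/
def frontIndex (code : List ℕ → ℕ) (r k e : ℕ) : ℕ :=
  -- Positions count from 0; S6 requires a nonempty block in front of the moved argument.
  if k = 0 then e else code [6, r, k, e]

section Kleene

variable {code : List ℕ → ℕ} {F : (ℕ → ℕ) → ℕ}

theorem kleeneEval_pad {k l e v : ℕ} {xs zs : List ℕ} (hk : xs.length = k) (hl : zs.length = l)
    (h : KleeneEval code F e xs v) : KleeneEval code F (padIndex code k l e) (xs ++ zs) v :=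
  .comp (by simp [hk, hl]) (.const (by simp [hk, hl]) e) (.call hk hl h)

theorem kleeneEval_front {r k e y v : ℕ} {xs zs : List ℕ} (hk : xs.length = k)
    (hr : (xs ++ y :: zs).length = r) (h : KleeneEval code F e (y :: (xs ++ zs)) v) :
    KleeneEval code F (frontIndex code r k e) (xs ++ y :: zs) v := by
  unfold frontIndex
  split_ifs with h0
  · rw [h0, List.length_eq_zero_iff] at hk
    subst hk
    exact h
  · subst hk hr
    exact .S6 e xs y zs v (by simpa using h0) h

/-- Moving the last argument, at position `N - 1`, to the front undoes one left rotation. -/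
theorem exists_kleeneEval_rotate (N j e : ℕ) : ∃ e', ∀ l : List ℕ, l.length = N → ∀ v,
    KleeneEval code F e l v → KleeneEval code F e' (l.rotate j) v := by
  induction j with
  | zero => exact ⟨e, fun l _ v h => by simpa using h⟩
  | succ j ih =>
    obtain ⟨e', he'⟩ := ih
    refine ⟨frontIndex code N (N - 1) e', fun l hl v h => ?_⟩
    have := he' l hl v h
    rw [← List.rotate_rotate]
    have hlen : (l.rotate j).length = N := by simpa using hl
    generalize l.rotate j = l' at this hlen
    cases l' with
    | nil =>
      subst hlen
      exact this
    | cons a t =>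
      rw [List.rotate_cons_succ, List.rotate_zero]
      refine kleeneEval_front (zs := []) ?_ ?_ (by simpa using this)
      · simp at hlen; omega
      · simpa using hlen

/-- S9 can only drop final arguments, so the unwanted first one is rotated to the end. -/
theorem exists_kleeneEval_tail (n e : ℕ) : ∃ e', ∀ (y : ℕ) (l : List ℕ), l.length = n → ∀ v,
    KleeneEval code F e l v → KleeneEval code F e' (y :: l) v := by
  obtain ⟨e', he'⟩ := exists_kleeneEval_rotate (code := code) (F := F) (n + 1) n
    (padIndex code n 1 e)
  refine ⟨e', fun y l hl v h => ?_⟩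
  have := he' (l ++ [y]) (by simpa using hl) v (kleeneEval_pad hl rfl h)
  rwa [← hl, List.rotate_append_length_eq] at this

/-- Simultaneous substitution, keeping the arguments. -/
theorem exists_kleeneEval_subst (m : ℕ) : ∀ (gs : List ℕ) (n h : ℕ), gs.length = m →
    ∃ e, ∀ l : List ℕ, l.length = n →
      ∀ ys, List.Forall₂ (fun g y => KleeneEval code F g l y) gs ys → ∀ v,
        KleeneEval code F h (ys ++ l) v → KleeneEval code F e l v := by
  induction m with
  | zero =>
    intro gs n h hgs
    obtain rfl := List.length_eq_zero_iff.1 hgs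
    exact ⟨h, fun l _ ys hys v hv => by cases hys; exact hv⟩
  | succ m ih =>
    rintro (_ | ⟨g, gs⟩) n h hgs
    · simp at hgs
    choose t ht using fun e => exists_kleeneEval_tail (code := code) (F := F) n e
    -- S4 puts the value `y` of `g` in front of `l`. The remaining functions must ignore it, hence
    -- `t`; their values then precede `y`, which `frontIndex` brings back to the front for `h`.
    obtain ⟨e, he⟩ := ih (gs.map t) (n + 1) (frontIndex code (m + (n + 1)) m h)
      (by simpa using hgs)
    refine ⟨code [4, n, e, g], fun l hl ys hys v hv => ?_⟩
    obtain _ | ⟨hy, hys⟩ := hys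
    rename_i y ys
    have hlen : ys.length = m := by rw [← hys.length_eq]; simpa using hgs
    refine .comp hl hy (he (y :: l) (by simpa using hl) ys ?_ v
      (kleeneEval_front hlen (by simp [hlen, hl]) hv))
    rw [List.forall₂_map_left_iff]
    exact hys.imp fun g z hz => ht g y l hl z hz

theorem exists_kleeneEval_comp {m : ℕ} (gs : Fin m → ℕ) (n h : ℕ) :
    ∃ e, ∀ l : List ℕ, l.length = n → ∀ ys : Fin m → ℕ,
      (∀ i, KleeneEval code F (gs i) l (ys i)) → ∀ v,
        KleeneEval code F h (List.ofFn ys) v → KleeneEval code F e l v := by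
  obtain ⟨e, he⟩ := exists_kleeneEval_subst (code := code) (F := F) m (List.ofFn gs) n
    (padIndex code m n h) (by simp)
  refine ⟨e, fun l hl ys hys v hv => he l hl (List.ofFn ys) ?_ v
    (kleeneEval_pad (by simp) hl hv)⟩
  rw [List.forall₂_iff_get]
  exact ⟨by simp, fun i h₁ h₂ => by simpa using hys ⟨i, by simpa using h₁⟩⟩

theorem kleeneEval_prec {n f g : ℕ} {l : List ℕ} (hl : l.length = n) (r : ℕ → ℕ)
    (h0 : KleeneEval code F f l (r 0))
    (hs : ∀ k, KleeneEval code F g (k :: r k :: l) (r (k + 1))) (k : ℕ) :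
    KleeneEval code F (code [5, n + 1, f, g]) (k :: l) (r k) := by
  subst hl
  induction k with
  | zero => exact .S5_zero f g l _ h0
  | succ k ih => exact .S5_succ f g k l _ _ ih (hs k)

theorem exists_kleeneEval_primrec' {n : ℕ} {f : List.Vector ℕ n → ℕ} (hf : Nat.Primrec' f) :
    ∃ e, ∀ x : List.Vector ℕ n, KleeneEval code F e x.toList (f x) := by
  induction hf with
  | zero => exact ⟨_, fun x => .const x.2 0⟩
  | succ =>
    refine ⟨code [1, 1], fun x => ?_⟩
    obtain ⟨a, rfl⟩ := List.Vector.exists_eq_cons x |>.imp fun a h => h.choose_spec.trans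
      (by rw [List.Vector.eq_nil h.choose])
    exact .S1 a []
  | @get n i =>
    refine ⟨frontIndex code n i (code [3, n]), fun x => ?_⟩
    have hi : (i : ℕ) < x.toList.length := by simp
    have hx : x.toList = x.toList.take i ++ x.get i :: x.toList.drop (i + 1) := by
      rw [List.Vector.get_eq_get_toList]
      conv_lhs => rw [← List.take_append_drop i x.toList, List.drop_eq_getElem_cons hi]
      simp
    have hlen := congrArg List.length hx
    rw [hx]
    refine kleeneEval_front (by simp) (hlen.symm.trans x.2) ?_
    have := KleeneEval.S3 (code := code) (F := F) (x.get i)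
      (x.toList.take i ++ x.toList.drop (i + 1))
    rwa [show (x.toList.take i ++ x.toList.drop (i + 1)).length + 1 = n by
      rw [List.Vector.toList_length] at hlen
      simp only [List.length_append, List.length_cons] at hlen ⊢
      exact hlen.symm] at this
  | @comp m _ f g _ _ ihf ihg =>
    obtain ⟨h, hh⟩ := ihf
    choose gs hgs using ihg
    obtain ⟨e, he⟩ := exists_kleeneEval_comp (code := code) (F := F) gs m h
    refine ⟨e, fun x => he x.toList x.2 (fun i => g i x) (fun i => hgs i x) _ ?_⟩
    simpa using hh (List.Vector.ofFn fun i => g i x)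
  | @prec n f g _ _ ihf ihg =>
    obtain ⟨ef, hf⟩ := ihf
    obtain ⟨eg, hg⟩ := ihg
    refine ⟨code [5, n + 1, ef, eg], fun x => ?_⟩
    obtain ⟨k, l, rfl⟩ := List.Vector.exists_eq_cons x
    simp only [List.Vector.head_cons, List.Vector.tail_cons, List.Vector.toList_cons]
    exact kleeneEval_prec l.toList_length
      (fun k => Nat.rec (f l) (fun y IH => g (y ::ᵥ IH ::ᵥ l)) k) (hf l)
      (fun k => by simpa using hg (k ::ᵥ _ ::ᵥ l)) k

theorem exists_kleeneEval_primrec {f : ℕ → ℕ} (hf : Primrec f) :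
    ∃ e, ∀ a, KleeneEval code F e [a] (f a) := by
  obtain ⟨e, he⟩ := exists_kleeneEval_primrec' (code := code) (F := F)
    (Nat.Primrec'.prim_iff₁.2 hf)
  exact ⟨e, fun a => by simpa using he (a ::ᵥ .nil)⟩

theorem exists_kleeneEval_primrec₂ {f : ℕ → ℕ → ℕ} (hf : Primrec₂ f) :
    ∃ e, ∀ a b, KleeneEval code F e [a, b] (f a b) := by
  obtain ⟨e, he⟩ := exists_kleeneEval_primrec' (code := code) (F := F)
    (Nat.Primrec'.prim_iff₂.2 hf)
  exact ⟨e, fun a b => by simpa using he (a ::ᵥ b ::ᵥ .nil)⟩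

theorem isEffective_kleeneApp (hcode : Primrec code) (hinj : Function.Injective code) :
    IsEffective (kleeneApp code F) := by
  refine ⟨fun f hf => ?_, fun h hh e₁ e₂ => ?_, ?_, ?_⟩
  · obtain ⟨e, he⟩ := exists_kleeneEval_primrec (code := code) (F := F) (Primrec.nat_iff.2 hf)
    exact ⟨e, fun n => (mem_kleeneApp hinj).2 (he n)⟩
  · obtain ⟨s, hs⟩ := exists_kleeneEval_primrec₂ (code := code) (F := F) hh.swap
    -- S4 pushes results to the front, so the arguments become `[x]`, `[y, x]`, `[h x y, y, x]`;
    -- this order is why `s` computes the swapped `h`.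
    refine ⟨code [4, 1, code [4, 2, padIndex code 1 2 e₂, s], e₁], fun x y hy z hz => ?_⟩
    rw [mem_kleeneApp hinj] at *
    exact .comp rfl hy (.comp rfl (hs y x) (kleeneEval_pad (xs := [_]) rfl rfl hz))
  · obtain ⟨r, hr⟩ := exists_kleeneEval_primrec (code := code) (F := F)
      (Primrec.snd.comp Primrec.unpair)
    obtain ⟨l, hl⟩ := exists_kleeneEval_primrec₂ (code := code) (F := F)
      (f := fun _ x => x.unpair.1) (Primrec.fst.comp (Primrec.unpair.comp Primrec.snd))
    -- With `n` the pair of `a` and `b`, the arguments become `[n]`, `[b, n]`, `[a, b, n]`; S9 then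
    -- applies `{a}` to `b` and drops `n`.
    refine ⟨code [4, 1, code [4, 2, code [9, 1, 1], l], r], fun a b c hc => ?_⟩
    rw [mem_kleeneApp hinj] at *
    refine .comp rfl (hr _) (.comp rfl (hl _ _) ?_)
    simp only [Nat.unpair_pair]
    exact .call (xs := [b]) rfl rfl hc
  · obtain ⟨q, hq⟩ := exists_kleeneEval_primrec₂ (code := code) (F := F) Primrec₂.natPair
    let S : ℕ → ℕ → ℕ := fun e x =>
      code [4, 1, code [4, 2, padIndex code 1 2 e, q], code [2, 1, x]]
    have hlist : ∀ {f g : ℕ × ℕ → ℕ} (a b : ℕ), Primrec f → Primrec g →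
        Primrec fun p => code [a, b, f p, g p] := fun a b hf hg =>
      hcode.comp (Primrec.list_cons.comp (Primrec.const a) (Primrec.list_cons.comp
        (Primrec.const b) (Primrec.list_cons.comp hf (Primrec.list_cons.comp hg
          (Primrec.const [])))))
    have hconst : ∀ {f : ℕ × ℕ → ℕ} (a b : ℕ), Primrec f →
        Primrec fun p => code [a, b, f p] := fun a b hf =>
      hcode.comp (Primrec.list_cons.comp (Primrec.const a) (Primrec.list_cons.comp
        (Primrec.const b) (Primrec.list_cons.comp hf (Primrec.const []))))
    have hS : Primrec₂ S := hlist 4 1 (hlist 4 2 (hlist 4 3 (Primrec.const _)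
      (hconst 2 3 Primrec.fst)) (Primrec.const q)) (hconst 2 1 Primrec.snd)
    obtain ⟨s, hs⟩ := exists_kleeneEval_primrec (code := code) (F := F)
      (f := fun n => S n.unpair.1 n.unpair.2)
      (hS.comp (Primrec.fst.comp Primrec.unpair) (Primrec.snd.comp Primrec.unpair))
    refine ⟨S, ⟨s, fun x y => (mem_kleeneApp hinj).2 (by simpa using hs (Nat.pair x y))⟩,
      fun e x y z hz => ?_⟩
    rw [mem_kleeneApp hinj] at *
    exact .comp rfl (.const (ns := [y]) rfl x) (.comp rfl (hq x y) (kleeneEval_pad (xs := [_]) rfl rfl hz))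

/-- The functional `F` is an effective operation on indices. -/
theorem exists_kleeneApp_functional (hinj : Function.Injective code) :
    ∃ d, ∀ (e : ℕ) (g : ℕ → ℕ), (∀ x, g x ∈ kleeneApp code F e x) →
      F g ∈ kleeneApp code F d e := by
  -- S8 supplies the arguments `[x, e]`; after `e` is moved to the front, S9 evaluates `{e}(x)`.
  refine ⟨code [8, 1, frontIndex code 2 1 (code [9, 1, 0])], fun e g hg => ?_⟩
  simp only [mem_kleeneApp hinj] at *
  exact .S8 _ [e] g fun x => kleeneEval_front (xs := [x]) (zs := []) rfl rfl
    (.call (xs := [x]) (zs := []) rfl rfl (hg x))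

end Kleene

/-! ### Interpreters in an arbitrary effective structure -/

/-- The functional `F` acts on indices of total functions. -/
def ActsOnIndices (app : ℕ → ℕ → Part ℕ) (F : (ℕ → ℕ) → ℕ) : Prop :=
  ∃ d, ∀ (e : ℕ) (g : ℕ → ℕ), (∀ x, g x ∈ app e x) → F g ∈ app d e

theorem exists_decode {code : List ℕ → ℕ} (hcode : Primrec code)
    (hinj : Function.Injective code) : ∃ d : ℕ →. List ℕ, Partrec d ∧ ∀ l, l ∈ d (code l) := by
  refine ⟨fun e => (Nat.rfind fun m => Part.some
    (decide (code (Denumerable.ofNat (List ℕ) m) = e))).map (Denumerable.ofNat (List ℕ)),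
    Partrec.map (Partrec.rfind ?_) ((Computable.ofNat _).comp Computable.snd), fun l => ?_⟩
  · exact ((Primrec.eq (α := ℕ)).decide.comp (hcode.comp ((Primrec.ofNat _).comp Primrec.snd))
      Primrec.fst).to_comp.partrec
  · refine (Part.mem_map_iff _).2 ⟨encode l, Nat.mem_rfind.2 ⟨by simp, fun {m} hm => ?_⟩,
      by simp⟩
    have : code (Denumerable.ofNat (List ℕ) m) ≠ code l := fun h => by
      have h := congrArg encode (hinj h)
      rw [Denumerable.encode_ofNat] at h
      exact hm.ne h
    simpa using this

/-- An effective structure on whose indices `F` acts evaluates Kleene's schemes. -/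
theorem IsEffective.exists_kleeneEval {app : ℕ → ℕ → Part ℕ} (H : IsEffective app)
    {F : (ℕ → ℕ) → ℕ} (hF : ActsOnIndices app F) {code : List ℕ → ℕ} (hcode : Primrec code)
    (hinj : Function.Injective code) :
    ∃ r, ∀ e ns v, KleeneEval code F e ns v → v ∈ app r (encode (e, ns)) := by
  obtain ⟨d, hd⟩ := hF
  obtain ⟨dec, hdec, hdec'⟩ := exists_decode hcode hinj
  -- For S8: from the interpreter `r`, the index `h` and the arguments `ns`, `t` produces an index
  -- of `x ↦ {h}(x, ns)`, to which `d` is applied.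
  obtain ⟨t, ht, ht'⟩ := H.rep_curry (α := ℕ × ℕ × List ℕ) (β := ℕ)
    (φ := fun q => app q.1.1 (encode (q.1.2.1, q.2 :: q.1.2.2)))
    (H.rep_run (Primrec.fst.comp Primrec.fst) (Primrec.encode.comp
      ((Primrec.fst.comp (Primrec.snd.comp Primrec.fst)).pair
        (Primrec.list_cons.comp Primrec.snd (Primrec.snd.comp (Primrec.snd.comp Primrec.fst))))))
  let Q := (ℕ × ℕ × List ℕ) × List ℕ
  let arg : ℕ → Q → ℕ := fun i q => q.2.getD i 0
  let args : Q → List ℕ := fun q => q.1.2.2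
  have harg : ∀ i, Primrec (arg i) := fun i =>
    (Primrec.list_getD 0).comp Primrec.snd (Primrec.const i)
  have hns : Primrec args := Primrec.snd.comp (Primrec.snd.comp Primrec.fst)
  have hhd : Primrec fun q => (args q).headI := Primrec.list_headI.comp hns
  have htl : Primrec fun q => (args q).tail := Primrec.list_tail.comp hns
  have htag : ∀ i, Primrec fun q => decide (arg 0 q = i) := fun i =>
    (Primrec.eq (α := ℕ)).decide.comp (harg 0) (Primrec.const i)
  have hpred : Primrec fun q => (args q).headI - 1 := Primrec.pred.comp hhd
  have hcall : ∀ {h : Q → ℕ} {l : Q → List ℕ}, Primrec h → Primrec l →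
      Rep app fun q : Q => app q.1.1 (encode (h q, l q)) := fun hh hl =>
    H.rep_run (Primrec.fst.comp Primrec.fst) (Primrec.encode.comp (hh.pair hl))
  have hcall₂ : ∀ {h : Q × ℕ → ℕ} {l : Q × ℕ → List ℕ}, Primrec h → Primrec l →
      Rep app fun p : Q × ℕ => app p.1.1.1 (encode (h p, l p)) := fun hh hl =>
    H.rep_run (Primrec.fst.comp (Primrec.fst.comp Primrec.fst)) (Primrec.encode.comp (hh.pair hl))
  -- One unfolding of the schemes, where `q` holds the interpreter, the index, the arguments and the
  -- decoded index. The final branch serves S9. Values on ill-formed input are irrelevant, since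
  -- only derivable evaluations are compared.
  let body : Q →. ℕ := fun q =>
    cond (decide (arg 0 q = 1)) (Part.some ((args q).headI + 1)) <|
    cond (decide (arg 0 q = 2)) (Part.some (arg 2 q)) <|
    cond (decide (arg 0 q = 3)) (Part.some (args q).headI) <|
    cond (decide (arg 0 q = 4)) ((app q.1.1 (encode (arg 3 q, args q))).bind fun y =>
      app q.1.1 (encode (arg 2 q, y :: args q))) <|
    cond (decide (arg 0 q = 5)) (cond (decide ((args q).headI = 0))
      (app q.1.1 (encode (arg 2 q, (args q).tail)))
      ((app q.1.1 (encode (q.1.2.1, ((args q).headI - 1) :: (args q).tail))).bind fun y =>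
        app q.1.1 (encode (arg 3 q, ((args q).headI - 1) :: y :: (args q).tail)))) <|
    cond (decide (arg 0 q = 6)) (app q.1.1 (encode (arg 3 q,
      (args q).getD (arg 2 q) 0 :: ((args q).take (arg 2 q) ++ (args q).drop (arg 2 q + 1))))) <|
    cond (decide (arg 0 q = 8)) ((Part.some (t (q.1.1, arg 2 q, args q))).bind fun i => app d i) <|
    app q.1.1 (encode ((args q).headI, (args q).tail.take (arg 1 q)))
  have hbody : Rep app body := by
    refine H.rep_cond (htag 1) (H.rep_primrec (Primrec.succ.comp hhd)) ?_
    refine H.rep_cond (htag 2) (H.rep_primrec (harg 2)) ?_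
    refine H.rep_cond (htag 3) (H.rep_primrec hhd) ?_
    refine H.rep_cond (htag 4) (H.rep_bind (hcall (harg 3) hns)
      (hcall₂ ((harg 2).comp Primrec.fst)
        (Primrec.list_cons.comp Primrec.snd (hns.comp Primrec.fst)))) ?_
    refine H.rep_cond (htag 5) (H.rep_cond
      ((Primrec.eq (α := ℕ)).decide.comp hhd (Primrec.const 0)) (hcall (harg 2) htl)
      (H.rep_bind (hcall (Primrec.fst.comp (Primrec.snd.comp Primrec.fst))
        (Primrec.list_cons.comp hpred htl)) (hcall₂ ((harg 3).comp Primrec.fst)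
          (Primrec.list_cons.comp (hpred.comp Primrec.fst)
            (Primrec.list_cons.comp Primrec.snd (htl.comp Primrec.fst)))))) ?_
    refine H.rep_cond (htag 6) (hcall (harg 3) (Primrec.list_cons.comp
      ((Primrec.list_getD 0).comp hns (harg 2)) (Primrec.list_append.comp
        (Primrec.list_take.comp (harg 2) hns)
        (Primrec.list_drop.comp (Primrec.succ.comp (harg 2)) hns)))) ?_
    refine H.rep_cond (htag 8) (H.rep_bind (H.rep_comp_primrec
      (f := fun q : Q => (q.1.1, arg 2 q, args q)) ht
      ((Primrec.fst.comp Primrec.fst).pair ((harg 2).pair hns)))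
      (H.rep_run (Primrec.const d) Primrec.snd)) ?_
    exact hcall hhd (Primrec.list_take.comp (harg 1) htl)
  obtain ⟨r, hr⟩ := H.rep_fix (φ := fun p : ℕ × ℕ × List ℕ =>
    (dec p.2.1).bind fun l => body (p, l))
    (H.rep_bind (H.rep_partrec (hdec.comp (Computable.fst.comp Computable.snd))) hbody)
  have key : ∀ l ns v, v ∈ body ((r, code l, ns), l) → v ∈ app r (encode (code l, ns)) :=
    fun l ns v hv => hr (code l, ns) v (Part.mem_bind (hdec' l) hv)
  refine ⟨r, fun e ns v h => ?_⟩
  induction h with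
  | S1 n ns => exact key _ _ _ (by simp [body, args, arg])
  | S2 m ns => exact key _ _ _ (by simp [body, arg])
  | S3 n ns => exact key _ _ _ (by simp [body, args, arg])
  | S4 g h ns y v _ _ ih₁ ih₂ =>
    have : v ∈ (app r (encode (h, ns))).bind fun y => app r (encode (g, y :: ns)) :=
      Part.mem_bind_iff.2 ⟨y, ih₁, ih₂⟩
    exact key _ _ _ this
  | S5_zero g h ns v _ ih => exact key _ _ _ ih
  | S5_succ g h k ns y v _ _ ih₁ ih₂ =>
    have : v ∈ (app r (encode (code [5, ns.length + 1, g, h], k :: ns))).bind fun y =>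
        app r (encode (h, k :: y :: ns)) := Part.mem_bind_iff.2 ⟨y, ih₁, ih₂⟩
    exact key _ _ _ this
  | S6 g xs y zs v _ _ ih =>
    refine key _ _ _ ?_
    simpa [body, args, arg, List.drop_append, List.drop_eq_nil_of_le] using ih
  | S8 h ns g _ ih =>
    refine key _ _ _ (Part.mem_bind (Part.mem_some _) (hd _ g fun x => ?_))
    exact ht' (r, h, ns) x (g x) (ih x)
  | S9 m xs zs v _ ih =>
    refine key _ _ _ ?_
    simpa [body, args, arg] using ih

/-- An effective structure on whose indices `F` acts evaluates the application of `K₁[F]`. -/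
theorem IsEffective.exists_force {app : ℕ → ℕ → Part ℕ} (H : IsEffective app)
    {F : (ℕ → ℕ) → ℕ} (hF : ActsOnIndices app F) (C : Combinators K1) :
    ∃ r, ∀ a b c, c ∈ force C (fun g => Part.some (F g)) a b → c ∈ app r (encode (a, b)) := by
  obtain ⟨d, hd⟩ := hF
  obtain ⟨run, hrun, hrun'⟩ := exists_strategy C
  obtain ⟨t, ht, ht'⟩ := H.rep_curry (α := ℕ × ℕ) (β := ℕ)
    (φ := fun q => app q.1.1 (encode (q.1.2, q.2, ([] : List ℕ))))
    (H.rep_run (Primrec.fst.comp Primrec.fst) (Primrec.encode.comp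
      ((Primrec.snd.comp Primrec.fst).pair (Primrec.snd.pair (Primrec.const [])))))
  have hval : Primrec (Sum.elim id id : ℕ ⊕ ℕ → ℕ) :=
    (Primrec.sumCasesOn Primrec.id Primrec.snd.to₂ Primrec.snd.to₂).of_eq
      fun r => by cases r <;> rfl
  have hright : Primrec (Sum.isRight : ℕ ⊕ ℕ → Bool) :=
    (Primrec.sumCasesOn Primrec.id (Primrec.const false).to₂ (Primrec.const true).to₂).of_eq
      fun r => by cases r <;> rfl
  -- The interpreter keeps the answers received so far as a list. A query `v` is answered by
  -- applying `d` to an index of `x ↦ e (v, x, [])`, that is, of the function `v` computes under the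
  -- interpreter itself.
  obtain ⟨e, he⟩ := H.rep_fix (α := ℕ × ℕ × List ℕ) (φ := fun p =>
    (run p.2.1 (p.2.2.1 :: p.2.2.2)).bind fun r =>
      cond r.isRight (Part.some (Sum.elim id id r))
        ((Part.some (t (p.1, Sum.elim id id r))).bind fun i => (app d i).bind fun w =>
          app p.1 (encode (p.2.1, p.2.2.1, p.2.2.2 ++ [w])))) (by
    refine H.rep_bind (H.rep_partrec (hrun.comp (Computable.fst.comp Computable.snd)
      (Computable.list_cons.comp
        (Computable.fst.comp (Computable.snd.comp Computable.snd))
        (Computable.snd.comp (Computable.snd.comp Computable.snd))))) ?_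
    refine H.rep_cond (hright.comp Primrec.snd) (H.rep_primrec (hval.comp Primrec.snd)) ?_
    refine H.rep_bind (H.rep_comp_primrec
      (f := fun q : (ℕ × ℕ × ℕ × List ℕ) × (ℕ ⊕ ℕ) => (q.1.1, Sum.elim id id q.2)) ht
      ((Primrec.fst.comp Primrec.fst).pair (hval.comp Primrec.snd))) ?_
    refine H.rep_bind (H.rep_run (Primrec.const d) Primrec.snd) ?_
    have h1 : Primrec fun q : (((ℕ × ℕ × ℕ × List ℕ) × (ℕ ⊕ ℕ)) × ℕ) × ℕ => q.1.1.1 :=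
      Primrec.fst.comp (Primrec.fst.comp Primrec.fst)
    have h2 := Primrec.snd.comp h1
    have h3 := Primrec.snd.comp h2
    exact H.rep_run (Primrec.fst.comp h1) (Primrec.encode.comp ((Primrec.fst.comp h2).pair
      ((Primrec.fst.comp h3).pair (Primrec.list_append.comp (Primrec.snd.comp h3)
        (Primrec.list_cons.comp Primrec.snd (Primrec.const [])))))))
  -- Stated for any oracle whose values `d` reproduces, so that it serves at each stage in the
  -- induction for `hstage` and then for the whole union.
  have key : ∀ (f : ℕ → Part ℕ) a b c, (∀ v, ∀ w ∈ f v, w ∈ app d (t (e, v))) →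
      c ∈ adjoin C f a b → c ∈ app e (encode (a, b, ([] : List ℕ))) := by
    intro f a b c hf hc
    obtain ⟨u, hu, hc⟩ := plays_of_mem_adjoin C hrun' hc
    suffices ∀ j i, i + j = u.length → c ∈ app e (encode (a, b, u.take i)) by
      simpa using this u.length 0 (by simp)
    intro j
    induction j with
    | zero =>
      rintro i rfl
      refine he (a, b, u.take _) c (Part.mem_bind (a := Sum.inr c) (by simpa using hc) ?_)
      simp
    | succ j ih =>
      intro i hi
      obtain ⟨v, hv, hw⟩ := hu i (by omega)
      refine he (a, b, u.take i) c (Part.mem_bind hv ?_)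
      refine Part.mem_bind (Part.mem_some _) (Part.mem_bind (hf v _ hw) ?_)
      have := ih (i + 1) (by omega)
      rwa [List.take_succ_eq_append_getElem (by omega)] at this
  have hstage : ∀ v, ∀ w ∈ stageUnion C (fun g => Part.some (F g)) v, w ∈ app d (t (e, v)) := by
    intro v w hw
    refine stageUnion_induction (P := fun v w => w ∈ app d (t (e, v))) ?_ hw
    intro f a g b hf hg hb
    obtain rfl := Part.mem_some_iff.1 hb
    exact hd _ g fun x => ht' (e, a) x (g x) (key f a x _ hf (hg x))
  obtain ⟨r, hr⟩ := H.rep_run (f := fun _ : ℕ × ℕ => e)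
    (g := fun p : ℕ × ℕ => encode (p.1, p.2, ([] : List ℕ))) (Primrec.const e)
    (Primrec.encode.comp (Primrec.fst.pair (Primrec.snd.pair (Primrec.const []))))
  exact ⟨r, fun a b c hc => hr (a, b) c (key _ a b c hstage hc)⟩

theorem actsOnIndices_force (C : Combinators K1) (F : (ℕ → ℕ) → ℕ) :
    ActsOnIndices (force C fun g => Part.some (F g)) F := by
  obtain ⟨q, hq⟩ := adjoin_query C (stageUnion C fun g => Part.some (F g))
  exact ⟨q, fun e g hg => hq e _ (stageUnion_of_index hg (Part.mem_some _))⟩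

/-! ### The identity relation as an isomorphism -/

theorem isApplicativeMorphism_eq {app app' : ℕ → ℕ → Part ℕ} {r : ℕ}
    (hr : ∀ a b, ∀ c ∈ app a b, c ∈ app2 app' r a b) :
    IsApplicativeMorphism app app' Eq :=
  ⟨fun a => ⟨a, rfl⟩, r, by
    rintro a b c hc _ _ rfl rfl
    exact ⟨c, hr a b c hc, rfl⟩⟩

/-- Total functions keep an index along a morphism carried by the identity. -/
theorem exists_index_of_app2 {app app' : ℕ → ℕ → Part ℕ} {r : ℕ}
    (hr : ∀ a b, ∀ c ∈ app a b, c ∈ app2 app' r a b) {e : ℕ} {g : ℕ → ℕ}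
    (he : ∀ n, g n ∈ app e n) : ∃ e', ∀ n, g n ∈ app' e' n := by
  choose x hx hx' using fun n => Part.mem_bind_iff.1 (hr e n _ (he n))
  -- Every `x n` is the value of `r` applied to `e`, so they all coincide; totality of `g`
  -- guarantees that this value exists.
  refine ⟨x 0, fun n => ?_⟩
  rw [Part.mem_unique (hx 0) (hx n)]
  exact hx' n

end ForcedPCA

open ForcedPCA

theorem mainTheorem3 (code : List ℕ → ℕ) (hcode : Primrec code)
    (hinj : Function.Injective code) (C : ForcedPCA.Combinators ForcedPCA.K1)
    (F : (ℕ → ℕ) → ℕ) :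
    ForcedPCA.IsPCA (ForcedPCA.force C (fun g => Part.some (F g))) ∧
    ForcedPCA.IsPCA (ForcedPCA.kleeneApp code F) ∧
    ForcedPCA.AreIsomorphic (ForcedPCA.force C (fun g => Part.some (F g)))
      (ForcedPCA.kleeneApp code F) ∧
    ∀ g : ℕ → ℕ, ForcedPCA.KleeneComputableIn code F g ↔
      (fun n => Part.some (g n)) ∈ ForcedPCA.PR (ForcedPCA.force C (fun g => Part.some (F g))) := by
  have HA : IsEffective (force C fun g => Part.some (F g)) := isEffective_adjoin C _
  have HB : IsEffective (kleeneApp code F) := isEffective_kleeneApp hcode hinj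
  obtain ⟨a, ha⟩ := HA.exists_kleeneEval (actsOnIndices_force C F) hcode hinj
  obtain ⟨b, hb⟩ := HB.exists_force (exists_kleeneApp_functional hinj) C
  obtain ⟨rA, hrA⟩ := HA.exists_app2
    (HA.rep_run (Primrec.const a) (Primrec.encode.comp (Primrec.fst.pair
      (Primrec.list_cons.comp Primrec.snd (Primrec.const [])))))
  obtain ⟨rB, hrB⟩ := HB.exists_app2 (HB.rep_run (Primrec.const b) (Primrec.encode (α := ℕ × ℕ)))
  have hBA : ∀ x y, ∀ z ∈ kleeneApp code F x y,
      z ∈ app2 (force C fun g => Part.some (F g)) rA x y := fun x y z hz =>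
    hrA x y z (ha x [y] z ((mem_kleeneApp hinj).1 hz))
  have hAB : ∀ x y, ∀ z ∈ force C (fun g => Part.some (F g)) x y,
      z ∈ app2 (kleeneApp code F) rB x y := fun x y z hz => hrB x y z (hb x y z hz)
  refine ⟨HA.isPCA, HB.isPCA, ⟨Eq, Eq, isApplicativeMorphism_eq hAB, isApplicativeMorphism_eq hBA,
    Relation.comp_eq, Relation.comp_eq⟩, fun g => ⟨?_, ?_⟩⟩
  · rintro ⟨e, he⟩
    obtain ⟨e', he'⟩ := exists_index_of_app2 hBA fun n => (mem_kleeneApp hinj).2 (he n)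
    exact ⟨e', fun n c hc => Part.mem_some_iff.1 hc ▸ he' n⟩
  · rintro ⟨e, he⟩
    obtain ⟨e', he'⟩ := exists_index_of_app2 hAB fun n => he n _ (Part.mem_some _)
    exact ⟨e', fun n => (mem_kleeneApp hinj).1 (he' n)⟩
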